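/- Let $p_1,p_2,p_3\in\mathbb R^2$ be the vertices of an equilateral triangle, $L_i(t)=\frac12(p_i+t)$, let $SG$ be the Sierpiński gasket (the unique non-empty compact set with $SG=\bigcup_{i=1}^3L_i(SG)$), $V_0=\{p_1,p_2,p_3\}$, and let $\mu$ be the self-similar Borel probability measure on $SG$ with $\mu=\frac13\sum_{i=1}^3\mu\circ L_i^{-1}$. For a word $w=w_1\cdots w_m$ over $\{1,2,3\}$ put $L_w=L_{w_1}\circ\cdots\circ L_{w_m}$, and let $$E_m(f,g)=\Big(\frac53\Big)^m\sum_{|w|=m}\ \sum_{1\le i<j\le3}\big(f(L_wp_i)-f(L_wp_j)\big)\big(g(L_wp_i)-g(L_wp_j)\big),\qquad E_m(f)=E_m(f,f).$$ A continuous $f:SG\to\mathbb R$ is harmonic if $E_m(f)=E_{m+1}(f)$ for all $m\ge0$. For $m\ge 0$ let $\mathcal S_m$ be the space of piecewise harmonic functions of level $m$, that is, of all continuous $h$ such that $h\circ L_w$ is harmonic for every $|w|=m$. For $n\ge0$ let $\mathcal H_n=\{f:\Delta^{n+1}f=0\}$ be the space of multiharmonic functions (polynomials) of order $n$, where $\Delta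 f=g$ means that $f$ is continuous with $\sup_mE_m(f)<\infty$, $g$ is continuous, and $\lim_mE_m(f,v)=-\int_{SG}gv\,d\mu$ for all continuous $v$ with $\sup_mE_m(v)<\infty$ and $v|_{V_0}=0$. Let $N\ge1$, let $\alpha_w\in\mathcal C(SG)$ with $\|\alpha_w\|_\infty<1$ for all $|w|=N$, and let $L:\mathcal C(SG)\to\mathcal C(SG)$ be a bounded linear operator with $(Lg)|_{V_0}=g|_{V_0}$ for all $g$. For $h\in\mathcal C(SG)$ let $h^\alpha=\mathcal F^\alpha(h)$ be the $\alpha$-fractal function of $h$, the continuous function with $$h^\alpha(L_w(t))=h(L_w(t))+\alpha_w(t)\big(h^\alpha(t)-(Lh)(t)\big)\qquad(t\in SG,\ |w|=N).$$ For a function $f:SG\to\mathbb R$ and $\mathcal S\subseteq\mathcal C(SG)$, a best one-sided approximant from below to $f$ in $\mathcal F^\alpha(\mathcal S)$ is an element of $$\mathcal Y_f^\alpha=\{h^\alpha\in\mathcal F^\alpha(\mathcal S): h^\alpha(t)\le f(t)\text{ for all }t\in SG\}$$ that maximizes $\int_{SG}h^\alpha\,d\mu$ over $\mathcal Y_f^\alpha$.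 1. Let $\mathcal S$ be one of the spaces $\mathcal S_m$ ($m\ge0$) or $\mathcal H_n$ ($n\ge0$), and let $f:SG\to\mathbb R$ be bounded below and $\mu$-integrable. If $\mathcal Y_f^\alpha\neq\emptyset$ or $L1=1$, then $f$ has a best one-sided approximant from below in $\mathcal F^\alpha(\mathcal S)$. 2. If $\|\alpha_w\|_\infty\|L\|<1$ for all $|w|=N$, then there is an $M$, depending only on $p_1,p_2,p_3$, $N$, $\alpha$ and $L$, such that for every $m\ge M$ every $f:SG\to\mathbb R$ that is bounded below and $\mu$-integrable has a best one-sided approximant from below in the class $\mathcal F^\alpha(\mathcal S_m)$ of fractal piecewise harmonic functions of level $m$. -/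

import Mathlib

open MeasureTheory Set Filter Topology

noncomputable section

namespace SierpinskiGasket

/-- The Euclidean plane. -/
abbrev Plane : Type := EuclideanSpace ℝ (Fin 2)

/-- The three points `p 0, p 1, p 2` are the vertices of a nondegenerate equilateral triangle. -/
def IsEquilateral (p : Fin 3 → Plane) : Prop :=
  ∃ d : ℝ, 0 < d ∧ ∀ i j : Fin 3, i ≠ j → dist (p i) (p j) = d

/-! ### The gasket as a subset of the plane -/

/-- The contraction `L_i (t) = (p_i + t) / 2` of the plane. -/
def planeMap (p : Fin 3 → Plane) (i : Fin 3) (t : Plane) : Plane :=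
  (1 / 2 : ℝ) • (p i + t)

/-- The point of the plane with address `ω`, that is, the limit of
`L_{ω 0} ∘ ⋯ ∘ L_{ω n} (t)` as `n → ∞`. -/
def code (p : Fin 3 → Plane) (ω : ℕ → Fin 3) : Plane :=
  ∑' k : ℕ, ((1 / 2 : ℝ) ^ (k + 1)) • p (ω k)

/-- The Sierpinski gasket with boundary vertices `p 0, p 1, p 2`, as the set of all points that
have an address. `isAttractor_gasket` and `eq_gasket` show that it is the attractor of the iterated
function system `L_0, L_1, L_2`: the unique non-empty compact set `K` with `K = ⋃ i, L_i '' K`. -/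
def gasket (p : Fin 3 → Plane) : Set Plane := Set.range (code p)

/-- The address `i ω_0 ω_1 ω_2 …`. -/
def consAddr (i : Fin 3) (ω : ℕ → Fin 3) : ℕ → Fin 3 :=
  fun n => Nat.casesOn n i ω

lemma summable_bound (p : Fin 3 → Plane) :
    Summable fun k : ℕ => (1 / 2 : ℝ) ^ (k + 1) * ∑ j, ‖p j‖ := by
  have h : Summable fun k : ℕ => (1 / 2 : ℝ) ^ (k + 1) :=
    (summable_nat_add_iff 1).2 (summable_geometric_of_lt_one (by norm_num) (by norm_num))
  exact h.mul_right _

lemma norm_code_term_le (p : Fin 3 → Plane) (k : ℕ) (ω : ℕ → Fin 3) :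
    ‖((1 / 2 : ℝ) ^ (k + 1)) • p (ω k)‖ ≤ (1 / 2 : ℝ) ^ (k + 1) * ∑ j, ‖p j‖ := by
  rw [norm_smul, Real.norm_of_nonneg (by positivity)]
  gcongr
  exact Finset.single_le_sum (f := fun j => ‖p j‖) (fun j _ => norm_nonneg _)
    (Finset.mem_univ (ω k))

lemma summable_code (p : Fin 3 → Plane) (ω : ℕ → Fin 3) :
    Summable fun k : ℕ => ((1 / 2 : ℝ) ^ (k + 1)) • p (ω k) :=
  Summable.of_norm_bounded (summable_bound p) fun k => norm_code_term_le p k ω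

lemma continuous_code (p : Fin 3 → Plane) : Continuous (code p) := by
  refine continuous_tsum (fun k => ?_) (summable_bound p) (fun k ω => norm_code_term_le p k ω)
  have h : Continuous fun ω : ℕ → Fin 3 => p (ω k) :=
    (continuous_of_discreteTopology (f := p)).comp (continuous_apply (A := fun _ : ℕ => Fin 3) k)
  exact h.const_smul ((1 / 2 : ℝ) ^ (k + 1))

lemma code_consAddr (p : Fin 3 → Plane) (i : Fin 3) (ω : ℕ → Fin 3) :
    code p (consAddr i ω) = planeMap p i (code p ω) := by
  unfold code planeMap
  rw [(summable_code p (consAddr i ω)).tsum_eq_zero_add, smul_add,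
    ← (summable_code p ω).tsum_const_smul]
  congr 1
  · simp [consAddr]
  · refine tsum_congr fun k => ?_
    simp only [consAddr]
    rw [smul_smul, ← pow_succ']

lemma consAddr_eta (ω : ℕ → Fin 3) : consAddr (ω 0) (fun n => ω (n + 1)) = ω := by
  funext n
  cases n <;> rfl

lemma code_const (p : Fin 3 → Plane) (i : Fin 3) : code p (fun _ => i) = p i := by
  have h := code_consAddr p i (fun _ => i)
  have h1 : consAddr i (fun _ => i) = fun _ => i := by
    funext n
    cases n <;> rfl
  rw [h1] at h
  have h2 : (2 : ℝ) • code p (fun _ => i) = p i + code p (fun _ => i) := by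
    conv_lhs => rw [h]
    rw [planeMap, smul_smul]
    norm_num
  rw [two_smul] at h2
  exact add_right_cancel h2

lemma dist_planeMap (p : Fin 3 → Plane) (i : Fin 3) (x y : Plane) :
    dist (planeMap p i x) (planeMap p i y) = (1 / 2) * dist x y := by
  simp [planeMap, dist_smul₀]

/-- The gasket is non-empty, compact and invariant under the iterated function system. -/
theorem isAttractor_gasket (p : Fin 3 → Plane) :
    (gasket p).Nonempty ∧ IsCompact (gasket p) ∧ gasket p = ⋃ i, planeMap p i '' gasket p := by
  refine ⟨Set.range_nonempty _, isCompact_range (continuous_code p), ?_⟩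
  ext x
  simp only [mem_iUnion, mem_image]
  constructor
  · rintro ⟨ω, rfl⟩
    refine ⟨ω 0, code p (fun n => ω (n + 1)), ⟨_, rfl⟩, ?_⟩
    rw [← code_consAddr, consAddr_eta]
  · rintro ⟨i, _, ⟨ω, rfl⟩, rfl⟩
    exact ⟨consAddr i ω, code_consAddr p i ω⟩

/-- The gasket is the only non-empty compact set that is invariant under the iterated function
system. -/
theorem eq_gasket (p : Fin 3 → Plane) (K : Set Plane) (hne : K.Nonempty) (hK : IsCompact K)
    (hinv : K = ⋃ i, planeMap p i '' K) : K = gasket p := by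
  -- points of one set are within `C / 2 ^ n` of the other set
  have key : ∀ A B : Set Plane, A.Nonempty → IsCompact A → IsCompact B → B.Nonempty →
      A ⊆ ⋃ i, planeMap p i '' A → (⋃ i, planeMap p i '' B) ⊆ B → A ⊆ B := by
    intro A B _ hA hB hBne hAi hBi
    obtain ⟨C, hC⟩ : ∃ C : ℝ, ∀ a ∈ A, ∀ b ∈ B, dist a b ≤ C := by
      obtain ⟨C, hC⟩ := (hA.isBounded.union hB.isBounded).exists_norm_le
      refine ⟨C + C, fun a ha b hb => ?_⟩
      exact (dist_le_norm_add_norm a b).trans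
        (add_le_add (hC a (Or.inl ha)) (hC b (Or.inr hb)))
    have step : ∀ n : ℕ, ∀ a ∈ A, ∃ b ∈ B, dist a b ≤ (1 / 2 : ℝ) ^ n * C := by
      intro n
      induction n with
      | zero =>
        intro a ha
        obtain ⟨b, hb⟩ := hBne
        exact ⟨b, hb, by simpa using hC a ha b hb⟩
      | succ n ih =>
        intro a ha
        obtain ⟨i, a', ha', rfl⟩ := by simpa only [mem_iUnion, mem_image] using hAi ha
        obtain ⟨b, hb, hab⟩ := ih a' ha'
        refine ⟨planeMap p i b, hBi (mem_iUnion.2 ⟨i, b, hb, rfl⟩), ?_⟩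
        rw [dist_planeMap, pow_succ']
        linarith
    intro a ha
    rw [← hB.isClosed.closure_eq, Metric.mem_closure_iff]
    intro ε hε
    have ht : Tendsto (fun n : ℕ => (1 / 2 : ℝ) ^ n * C) atTop (𝓝 0) := by
      simpa using (tendsto_pow_atTop_nhds_zero_of_lt_one (r := (1 / 2 : ℝ))
        (by norm_num) (by norm_num)).mul_const C
    obtain ⟨n, hn⟩ := (ht.eventually_lt_const hε).exists
    obtain ⟨b, hb, hab⟩ := step n a ha
    exact ⟨b, hb, hab.trans_lt hn⟩
  obtain ⟨hgne, hgc, hgi⟩ := isAttractor_gasket p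
  exact Subset.antisymm (key K _ hne hK hgc hgne hinv.le hgi.ge)
    (key _ K hgne hgc hK hne hgi.le hinv.ge)

/-! ### The gasket as a space -/

/-- The Sierpinski gasket as a (compact metric) space. -/
abbrev SG (p : Fin 3 → Plane) : Type := ↥(gasket p)

instance (p : Fin 3 → Plane) : CompactSpace (SG p) :=
  isCompact_iff_compactSpace.1 (isAttractor_gasket p).2.1

/-- The point of the gasket with address `ω`. -/
def address (p : Fin 3 → Plane) (ω : ℕ → Fin 3) : SG p := ⟨code p ω, ω, rfl⟩

/-- The boundary vertex `p i` of the gasket; these three points form `V_0`. -/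
def vertex (p : Fin 3 → Plane) (i : Fin 3) : SG p := ⟨p i, fun _ => i, code_const p i⟩

/-- The contraction `L_i` of the gasket. -/
def contr (p : Fin 3 → Plane) (i : Fin 3) (x : SG p) : SG p :=
  ⟨planeMap p i x,
    (isAttractor_gasket p).2.2.ge (mem_iUnion.2 ⟨i, x, x.2, rfl⟩)⟩

/-- `L_w = L_{w 0} ∘ L_{w 1} ∘ ⋯ ∘ L_{w (m - 1)}` for a word `w` of length `m` (the identity for
the empty word). -/
def cellMap (p : Fin 3 → Plane) : (m : ℕ) → (Fin m → Fin 3) → SG p → SG p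
  | 0, _, x => x
  | m + 1, w, x => contr p (w 0) (cellMap p m (Fin.tail w) x)

/-! ### The self-similar measure -/

/-- The uniform probability measure on the three letters. -/
def letterMeasure : Measure (Fin 3) := (PMF.uniformOfFintype (Fin 3)).toMeasure

instance : IsProbabilityMeasure letterMeasure := by
  unfold letterMeasure; infer_instance

/-- The self-similar probability measure on the gasket with weights `(1/3, 1/3, 1/3)`: the law of
the point whose address is a sequence of independent uniformly distributed letters. See
`selfSimilarMeasure_eq` for its self-similarity. -/
def selfSimilarMeasure (p : Fin 3 → Plane) : Measure (SG p) :=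
  (Measure.infinitePi fun _ : ℕ => letterMeasure).map (address p)

lemma continuous_address (p : Fin 3 → Plane) : Continuous (address p) :=
  (continuous_code p).subtype_mk _

instance (p : Fin 3 → Plane) : IsProbabilityMeasure (selfSimilarMeasure p) :=
  Measure.isProbabilityMeasure_map (continuous_address p).measurable.aemeasurable

lemma measurable_consAddr (i : Fin 3) : Measurable (consAddr i) := by
  refine measurable_pi_iff.2 fun n => ?_
  cases n with
  | zero => exact measurable_const
  | succ n => exact measurable_pi_apply n

lemma continuous_contr (p : Fin 3 → Plane) (i : Fin 3) : Continuous (contr p i) := by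
  unfold contr planeMap
  fun_prop

lemma letterMeasure_apply (t : Set (Fin 3)) :
    letterMeasure t = ∑ i, t.indicator (fun _ => (3 : ENNReal)⁻¹) i := by
  rw [letterMeasure, PMF.toMeasure_apply_fintype _ t]
  simp [Set.indicator]

lemma infinitePi_letterMeasure_eq :
    (Measure.infinitePi fun _ : ℕ => letterMeasure) =
      (3 : ENNReal)⁻¹ • ∑ i, (Measure.infinitePi fun _ : ℕ => letterMeasure).map (consAddr i) := by
  symm
  refine Measure.eq_infinitePi _ fun s t ht => ?_
  classical
  -- enlarge the index set so that it is an initial segment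
  obtain ⟨n, hn⟩ : ∃ n, s ⊆ Finset.range (n + 1) :=
    ⟨s.sup id, fun k hk => Finset.mem_range.2 (Nat.lt_succ_of_le (Finset.le_sup (f := id) hk))⟩
  set t' : ℕ → Set (Fin 3) := fun k => if k ∈ s then t k else univ with ht'
  have hset : (s : Set ℕ).pi t = (Finset.range (n + 1) : Set ℕ).pi t' := by
    ext ω
    simp only [Set.mem_pi, Finset.mem_coe, ht']
    constructor
    · intro h k _
      by_cases hk : k ∈ s
      · simpa [hk] using h k hk
      · simp [hk]
    · intro h k hk
      simpa [hk] using h k (hn hk)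
  have hprod : ∏ i ∈ s, letterMeasure (t i) = ∏ i ∈ Finset.range (n + 1), letterMeasure (t' i) := by
    rw [← Finset.prod_subset hn (f := fun i => letterMeasure (t' i))]
    · exact Finset.prod_congr rfl fun i hi => by simp [ht', hi]
    · intro i _ hi
      simp [ht', hi]
  rw [hset, hprod, Finset.prod_range_succ']
  have hmeas : MeasurableSet ((Finset.range (n + 1) : Set ℕ).pi t') :=
    MeasurableSet.pi (Finset.countable_toSet _) fun _ _ => MeasurableSet.of_discrete
  have hmap : ∀ i, (Measure.infinitePi fun _ : ℕ => letterMeasure).map (consAddr i)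
      ((Finset.range (n + 1) : Set ℕ).pi t') =
      (t' 0).indicator (fun _ => ∏ k ∈ Finset.range n, letterMeasure (t' (k + 1))) i := by
    intro i
    rw [Measure.map_apply (measurable_consAddr i) hmeas]
    by_cases hi : i ∈ t' 0
    · rw [Set.indicator_of_mem hi, ← Measure.infinitePi_pi (μ := fun _ : ℕ => letterMeasure)
        (s := Finset.range n) (t := fun k => t' (k + 1))
        (fun _ _ => MeasurableSet.of_discrete)]
      congr 1
      ext ω
      simp only [mem_preimage, Set.mem_pi, Finset.mem_coe, Finset.mem_range]
      constructor
      · intro h k hk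
        exact h (k + 1) (by omega)
      · intro h k hk
        cases k with
        | zero => exact hi
        | succ k => exact h k (by omega)
    · rw [Set.indicator_of_notMem hi]
      convert measure_empty (μ := Measure.infinitePi fun _ : ℕ => letterMeasure)
      ext ω
      simp only [mem_preimage, Set.mem_pi, Finset.mem_coe, Finset.mem_range, mem_empty_iff_false,
        iff_false]
      exact fun h => hi (h 0 (by omega))
  rw [Measure.smul_apply, Measure.finsetSum_apply, letterMeasure_apply, smul_eq_mul,
    Finset.mul_sum, Finset.mul_sum]
  refine Finset.sum_congr rfl fun i _ => ?_
  rw [hmap]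
  by_cases hi : i ∈ t' 0 <;> simp [hi, mul_comm]

/-- Self-similarity `μ = (1/3) ∑ i, μ ∘ L_i⁻¹` of the measure. -/
theorem selfSimilarMeasure_eq (p : Fin 3 → Plane) :
    selfSimilarMeasure p =
      (3 : ENNReal)⁻¹ • ∑ i, (selfSimilarMeasure p).map (contr p i) := by
  have hadd : ∀ i, (selfSimilarMeasure p).map (contr p i) =
      ((Measure.infinitePi fun _ : ℕ => letterMeasure).map (consAddr i)).map (address p) := by
    intro i
    rw [selfSimilarMeasure, Measure.map_map (continuous_contr p i).measurable
      (continuous_address p).measurable, Measure.map_map (continuous_address p).measurable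
      (measurable_consAddr i)]
    congr 1
    funext ω
    exact Subtype.ext (code_consAddr p i ω).symm
  simp only [hadd]
  conv_lhs => rw [selfSimilarMeasure, infinitePi_letterMeasure_eq]
  rw [Measure.map_smul]
  congr 1
  ext s hs
  rw [Measure.map_apply (continuous_address p).measurable hs]
  simp only [Measure.finsetSum_apply]
  exact Finset.sum_congr rfl fun i _ =>
    (Measure.map_apply (continuous_address p).measurable hs).symm

/-! ### Energy, harmonic functions, Laplacian -/

/-- The graph energy form `E_m (f, g) = (5/3)^m ∑_{x ∼_m y} (f x - f y) (g x - g y)`. The edges of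
the graph `Γ_m` are the three sides of the triangles `L_w (V_0)`, `|w| = m`, and two different
triangles share at most one vertex, so the sum over the (unordered) edges is the sum over the words
`w` and over the three sides `{p_i, p_{i+1}}` (indices modulo 3) of the triangle of `w`. -/
def graphEnergy (p : Fin 3 → Plane) (m : ℕ) (f g : SG p → ℝ) : ℝ :=
  (5 / 3 : ℝ) ^ m * ∑ w : Fin m → Fin 3, ∑ i : Fin 3,
    (f (cellMap p m w (vertex p i)) - f (cellMap p m w (vertex p (i + 1)))) *
      (g (cellMap p m w (vertex p i)) - g (cellMap p m w (vertex p (i + 1))))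

/-- Harmonic functions: the continuous functions whose graph energies on all levels agree. -/
def IsHarmonic (p : Fin 3 → Plane) (f : SG p → ℝ) : Prop :=
  Continuous f ∧ ∀ m : ℕ, graphEnergy p m f f = graphEnergy p (m + 1) f f

/-- `dom 𝓔`: the continuous functions of finite energy (the graph energies are nondecreasing in
the level, so that the limit is finite if and only if they are bounded). -/
def FiniteEnergy (p : Fin 3 → Plane) (f : SG p → ℝ) : Prop :=
  Continuous f ∧ BddAbove (Set.range fun m : ℕ => graphEnergy p m f f)

/-- `f ∈ dom Δ` with `Δ f = g`, in the weak formulation: `𝓔 (f, v) = - ∫ g v dμ` for all `v` of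
finite energy that vanish on `V_0`, where `𝓔 (f, v) = lim E_m (f, v)`. -/
def HasLaplacian (p : Fin 3 → Plane) (f g : SG p → ℝ) : Prop :=
  FiniteEnergy p f ∧ Continuous g ∧
    ∀ v : SG p → ℝ, FiniteEnergy p v → (∀ i, v (vertex p i) = 0) →
      Tendsto (fun m : ℕ => graphEnergy p m f v) atTop
        (𝓝 (-∫ x, g x * v x ∂(selfSimilarMeasure p)))

/-- `Δ^(n+1) f = 0`, that is, `f` is a polynomial (multiharmonic function) of order `n` on the
gasket. -/
def IsMultiharmonic (p : Fin 3 → Plane) : ℕ → (SG p → ℝ) → Prop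
  | 0, f => HasLaplacian p f fun _ => 0
  | n + 1, f => ∃ g : SG p → ℝ, HasLaplacian p f g ∧ IsMultiharmonic p n g

/-- The space `𝓢(H_0, V_m, ℝ)` of piecewise harmonic functions of level `m`. -/
def piecewiseHarmonic (p : Fin 3 → Plane) (m : ℕ) : Set C(SG p, ℝ) :=
  {h | ∀ w : Fin m → Fin 3, IsHarmonic p fun x => h (cellMap p m w x)}

/-- The space `𝓗_n(SG)` of polynomials (multiharmonic functions) of order `n`. -/
def multiharmonic (p : Fin 3 → Plane) (n : ℕ) : Set C(SG p, ℝ) :=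
  {h | IsMultiharmonic p n h}

/-! ### Fractal functions and one-sided approximation -/

/-- `u` is the `α`-fractal function `h^α = 𝓕^α h` of `h` (with base function `L h` and with the
scaling functions `α w`, `|w| = N`): the continuous function that satisfies the self-referential
equation `u (L_w t) = h (L_w t) + α_w (t) (u (t) - (L h) (t))` for all `t` and all `|w| = N`. -/
def IsFractalFunction (p : Fin 3 → Plane) {N : ℕ} (α : (Fin N → Fin 3) → C(SG p, ℝ))
    (L : C(SG p, ℝ) →L[ℝ] C(SG p, ℝ)) (h u : C(SG p, ℝ)) : Prop :=
  ∀ (w : Fin N → Fin 3) (t : SG p),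
    u (cellMap p N w t) = h (cellMap p N w t) + α w t * (u t - L h t)

/-- The class `𝓕^α (S)` of the `α`-fractal functions of the members of `S`. -/
def fractalClass (p : Fin 3 → Plane) {N : ℕ} (α : (Fin N → Fin 3) → C(SG p, ℝ))
    (L : C(SG p, ℝ) →L[ℝ] C(SG p, ℝ)) (S : Set C(SG p, ℝ)) : Set C(SG p, ℝ) :=
  {u | ∃ h ∈ S, IsFractalFunction p α L h u}

/-- The members of the class `Y` that lie below `f`. -/
def below (p : Fin 3 → Plane) (Y : Set C(SG p, ℝ)) (f : SG p → ℝ) : Set C(SG p, ℝ) :=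
  {u | u ∈ Y ∧ ∀ t, u t ≤ f t}

/-- `u` is a best one-sided approximant from below to `f` in the class `Y`: it has the largest
integral among the members of `Y` that lie below `f`. -/
def IsBestFromBelow (p : Fin 3 → Plane) (Y : Set C(SG p, ℝ)) (f : SG p → ℝ)
    (u : C(SG p, ℝ)) : Prop :=
  u ∈ below p Y f ∧ ∀ v ∈ below p Y f,
    ∫ t, v t ∂(selfSimilarMeasure p) ≤ ∫ t, u t ∂(selfSimilarMeasure p)

end SierpinskiGasket

end

open SierpinskiGasket

noncomputable section

namespace SierpinskiGasket

variable {p : Fin 3 → Plane}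

/-! ### Geometry of the cells -/

lemma exists_contr_eq (x : SG p) : ∃ i y, contr p i y = x := by
  obtain ⟨x, hx⟩ := x
  obtain ⟨i, y, hy, h⟩ := by
    simpa only [mem_iUnion, mem_image] using (isAttractor_gasket p).2.2.le hx
  exact ⟨i, ⟨y, hy⟩, Subtype.ext h⟩

lemma contr_vertex_self (i : Fin 3) : contr p i (vertex p i) = vertex p i := by
  refine Subtype.ext ?_
  change (1 / 2 : ℝ) • (p i + p i) = p i
  rw [← two_smul ℝ, smul_smul]
  norm_num

lemma contr_vertex_comm (i j : Fin 3) : contr p i (vertex p j) = contr p j (vertex p i) := by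
  refine Subtype.ext ?_
  change (1 / 2 : ℝ) • (p i + p j) = (1 / 2 : ℝ) • (p j + p i)
  rw [add_comm]

lemma dist_contr (i : Fin 3) (x y : SG p) :
    dist (contr p i x) (contr p i y) = (1 / 2) * dist x y :=
  dist_planeMap p i x y

lemma contr_injective (i : Fin 3) : Function.Injective (contr p i) := by
  intro x y h
  have h1 := dist_contr i x y
  rw [h, dist_self] at h1
  exact dist_eq_zero.1 (by linarith)

lemma contr_address (i : Fin 3) (ω : ℕ → Fin 3) :
    contr p i (address p ω) = address p (consAddr i ω) :=
  Subtype.ext (code_consAddr p i ω).symm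

lemma address_const (i : Fin 3) : address p (fun _ => i) = vertex p i :=
  Subtype.ext (code_const p i)

lemma address_surjective : Function.Surjective (address p) := by
  rintro ⟨_, ω, rfl⟩
  exact ⟨ω, rfl⟩

lemma continuous_cellMap (m : ℕ) (w : Fin m → Fin 3) : Continuous (cellMap p m w) := by
  induction m with
  | zero => exact continuous_id
  | succ m ih => exact (continuous_contr p _).comp (ih _)

lemma cellMap_cons (m : ℕ) (i : Fin 3) (w : Fin m → Fin 3) (x : SG p) :
    cellMap p (m + 1) (Fin.cons i w) x = contr p i (cellMap p m w x) := by
  simp [cellMap]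

lemma cellMap_snoc (m : ℕ) (w : Fin m → Fin 3) (i : Fin 3) (x : SG p) :
    cellMap p (m + 1) (Fin.snoc w i) x = cellMap p m w (contr p i x) := by
  induction m with
  | zero => rfl
  | succ m ih =>
    rw [← Fin.cons_self_tail w, ← Fin.cons_snoc_eq_snoc_cons, cellMap_cons, ih, cellMap_cons]

lemma cellMap_surjective (m : ℕ) (x : SG p) : ∃ w y, cellMap p m w y = x := by
  induction m generalizing x with
  | zero => exact ⟨Fin.elim0, x, rfl⟩
  | succ m ih =>
    obtain ⟨i, y, rfl⟩ := exists_contr_eq x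
    obtain ⟨w, z, rfl⟩ := ih y
    exact ⟨Fin.cons i w, z, cellMap_cons m i w z⟩

lemma cellMap_const_vertex (m : ℕ) (i : Fin 3) :
    cellMap p m (fun _ => i) (vertex p i) = vertex p i := by
  induction m with
  | zero => rfl
  | succ m ih => exact (congrArg (contr p i) ih).trans (contr_vertex_self i)

lemma dist_cellMap (m : ℕ) (w : Fin m → Fin 3) (x y : SG p) :
    dist (cellMap p m w x) (cellMap p m w y) = (1 / 2) ^ m * dist x y := by
  induction m with
  | zero => simp [cellMap]
  | succ m ih => rw [cellMap, cellMap, dist_contr, ih, pow_succ']; ring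

lemma exists_dist_cellMap_lt {ε : ℝ} (hε : 0 < ε) :
    ∃ M : ℕ, ∀ m, M ≤ m → ∀ (w : Fin m → Fin 3) (x y : SG p),
      dist (cellMap p m w x) (cellMap p m w y) < ε := by
  have ht : Tendsto (fun n : ℕ => (1 / 2 : ℝ) ^ n * Metric.diam (univ : Set (SG p))) atTop
      (𝓝 0) := by
    simpa using (tendsto_pow_atTop_nhds_zero_of_lt_one (r := (1 / 2 : ℝ))
      (by norm_num) (by norm_num)).mul_const (Metric.diam (univ : Set (SG p)))
  obtain ⟨M, hM⟩ := eventually_atTop.1 (ht.eventually_lt_const hε)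
  refine ⟨M, fun m hm w x y => lt_of_le_of_lt ?_ (hM m hm)⟩
  rw [dist_cellMap]
  gcongr
  exact Metric.dist_le_diam_of_mem isCompact_univ.isBounded (mem_univ x) (mem_univ y)

lemma max_of_gasket {φ : Plane →L[ℝ] ℝ} {j : Fin 3} (hφ : ∀ k, k ≠ j → φ (p k) < φ (p j))
    (x : SG p) : φ x ≤ φ (p j) ∧ (φ x = φ (p j) → x = vertex p j) := by
  have hle : ∀ k, φ (p k) ≤ φ (p j) := fun k => by
    by_cases hk : k = j
    · rw [hk]
    · exact (hφ k hk).le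
  have hc : ∀ k (y : SG p), φ (contr p k y) = (φ (p k) + φ y) / 2 := fun k y => by
    change φ ((1 / 2 : ℝ) • (p k + y)) = _
    rw [map_smul, map_add, smul_eq_mul]
    ring
  have hmax : ∀ x : SG p, φ x ≤ φ (p j) := by
    obtain ⟨z, -, hz⟩ := (isCompact_univ (X := SG p)).exists_isMaxOn ⟨x, mem_univ _⟩
      (f := fun x : SG p => φ x) (by fun_prop)
    obtain ⟨k, y, rfl⟩ := exists_contr_eq z
    intro x
    have h1 := hz (mem_univ x)
    have h2 := hz (mem_univ y)
    simp only [mem_ofPred_eq, hc] at h1 h2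
    linarith [hle k]
  refine ⟨hmax x, fun hx => ?_⟩
  have hK : IsCompact {y : SG p | φ y = φ (p j)} :=
    (isClosed_eq (by fun_prop) continuous_const).isCompact
  obtain ⟨z, hz, hzm⟩ := hK.exists_isMaxOn ⟨x, hx⟩ (f := fun y => dist y (vertex p j))
    (by fun_prop)
  obtain ⟨k, y, rfl⟩ := exists_contr_eq z
  rw [mem_ofPred_eq, hc] at hz
  have hk : k = j := by
    by_contra hk
    linarith [hφ k hk, hmax y]
  subst hk
  have h1 := hzm (show y ∈ _ by rw [mem_ofPred_eq]; linarith)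
  have h2 := hzm (show x ∈ _ from hx)
  have h3 := dist_contr k y (vertex p k)
  rw [contr_vertex_self] at h3
  simp only [mem_ofPred_eq] at h1 h2
  exact dist_le_zero.1 (by linarith)

/-- Two different cells of level one meet in a common vertex at most. -/
lemma eq_vertex_of_contr_eq (hp : IsEquilateral p) {i j : Fin 3} (hij : i ≠ j) {x y : SG p}
    (h : contr p i x = contr p j y) : x = vertex p j ∧ y = vertex p i := by
  obtain ⟨d, hd, hdist⟩ := hp
  have hφ : ∀ i j : Fin 3, i ≠ j → ∀ k, k ≠ j →
      innerSL ℝ (p j - p i) (p k) < innerSL ℝ (p j - p i) (p j) := by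
    intro i j hij k hk
    simp only [innerSL_apply_apply]
    rw [← sub_pos, ← inner_sub_right]
    have h1 : ‖p j - p i‖ = d := by rw [← dist_eq_norm]; exact hdist _ _ hij.symm
    have h2 : ‖p j - p k‖ = d := by rw [← dist_eq_norm]; exact hdist _ _ hk.symm
    have h3 : ‖p k - p i‖ = d ∨ p k - p i = 0 := by
      by_cases hki : k = i
      · right; rw [hki, sub_self]
      · left; rw [← dist_eq_norm]; exact hdist _ _ hki
    have h4 := norm_sub_sq_real (p j - p i) (p j - p k)
    rw [sub_sub_sub_cancel_left, h1, h2] at h4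
    rcases h3 with h3 | h3
    · rw [h3] at h4; nlinarith
    · rw [h3, norm_zero] at h4; nlinarith
  have hxy : p i + (x : Plane) = p j + y := by
    have h1 : (1 / 2 : ℝ) • (p i + (x : Plane)) = (1 / 2 : ℝ) • (p j + (y : Plane)) :=
      congrArg Subtype.val h
    exact smul_right_injective _ (by norm_num : (1 / 2 : ℝ) ≠ 0) h1
  have hx := max_of_gasket (hφ i j hij) x
  have hy := max_of_gasket (hφ j i hij.symm) y
  have h1 := congrArg (innerSL ℝ (p j - p i)) hxy
  have h2 : ∀ z, innerSL ℝ (p i - p j) z = - innerSL ℝ (p j - p i) z := fun z => by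
    rw [← neg_sub (p j) (p i), map_neg]; rfl
  simp only [h2, map_add] at *
  exact ⟨hx.2 (by linarith [hx.1, hy.1]), hy.2 (by linarith [hx.1, hy.1])⟩

lemma vertex_injective (hp : IsEquilateral p) : Function.Injective (vertex p) := by
  intro i j h
  by_contra hij
  obtain ⟨d, hd, hdist⟩ := hp
  have h1 := hdist i j hij
  rw [show p i = p j from congrArg Subtype.val h, dist_self] at h1
  exact hd.ne h1

lemma eq_of_contr_eq_vertex (hp : IsEquilateral p) {i j : Fin 3} {x : SG p}
    (h : contr p i x = vertex p j) : i = j ∧ x = vertex p j := by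
  by_cases hij : i = j
  · subst hij
    exact ⟨rfl, contr_injective i (h.trans (contr_vertex_self i).symm)⟩
  · rw [← contr_vertex_self j] at h
    exact absurd (vertex_injective hp (eq_vertex_of_contr_eq hp hij h).2).symm hij

lemma eq_of_cellMap_eq_vertex (hp : IsEquilateral p) {m : ℕ} {w : Fin m → Fin 3} {j : Fin 3}
    {x : SG p} (h : cellMap p m w x = vertex p j) : x = vertex p j := by
  induction m with
  | zero => exact h
  | succ m ih => exact ih (eq_of_contr_eq_vertex hp h).2

/-- Cells of the same level meet in common vertices only. -/
lemma eq_or_vertex_of_cellMap_eq (hp : IsEquilateral p) {m : ℕ} {v w : Fin m → Fin 3}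
    {x y : SG p} (h : cellMap p m v x = cellMap p m w y) :
    (v = w ∧ x = y) ∨ ∃ i j, x = vertex p i ∧ y = vertex p j := by
  induction m with
  | zero => exact Or.inl ⟨Subsingleton.elim _ _, h⟩
  | succ m ih =>
    rw [cellMap, cellMap] at h
    by_cases h0 : v 0 = w 0
    · rw [h0] at h
      rcases ih (contr_injective _ h) with ⟨h1, h2⟩ | h1
      · left
        refine ⟨?_, h2⟩
        rw [← Fin.cons_self_tail v, ← Fin.cons_self_tail w, h0, h1]
      · exact Or.inr h1
    · obtain ⟨h1, h2⟩ := eq_vertex_of_contr_eq hp h0 h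
      exact Or.inr ⟨_, _, eq_of_cellMap_eq_vertex hp h1, eq_of_cellMap_eq_vertex hp h2⟩

/-- Continuous functions on the cells of level `m` that agree at common points are the
restrictions of a continuous function on the gasket. -/
lemma exists_glue (m : ℕ) (g : (Fin m → Fin 3) → C(SG p, ℝ))
    (hg : ∀ v w x y, cellMap p m v x = cellMap p m w y → g v x = g w y) :
    ∃ u : C(SG p, ℝ), ∀ w x, u (cellMap p m w x) = g w x := by
  let c : C((Fin m → Fin 3) × SG p, SG p) :=
    ⟨fun q => cellMap p m q.1 q.2,
      continuous_prod_of_discrete_left.2 fun w => continuous_cellMap m w⟩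
  have hc : IsQuotientMap c := by
    refine IsQuotientMap.of_surjective_continuous (fun x => ?_) c.continuous
    obtain ⟨w, y, h⟩ := cellMap_surjective m x
    exact ⟨(w, y), h⟩
  let G : C((Fin m → Fin 3) × SG p, ℝ) :=
    ⟨fun q => g q.1 q.2, continuous_prod_of_discrete_left.2 fun w => (g w).continuous⟩
  have hG : Function.FactorsThrough G c := fun q r h => hg _ _ _ _ h
  refine ⟨hc.lift G hG, fun w x => ?_⟩
  exact DFunLike.congr_fun (hc.lift_comp G hG) (w, x)

lemma exists_cellMap_dist_lt (x : SG p) {ε : ℝ} (hε : 0 < ε) :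
    ∃ m, ∃ w : Fin m → Fin 3, ∀ y, dist (cellMap p m w y) x < ε := by
  obtain ⟨m, hm⟩ := exists_dist_cellMap_lt (p := p) hε
  obtain ⟨w, z, rfl⟩ := cellMap_surjective m x
  exact ⟨m, w, fun y => hm m le_rfl w y z⟩

/-- A continuous function that vanishes at all vertices of all cells is zero. -/
lemma eq_zero_of_cellMap_vertex {f : SG p → ℝ} (hf : Continuous f)
    (h : ∀ m w, f (cellMap p m w (vertex p 0)) = 0) (x : SG p) : f x = 0 := by
  have hd : Dense {x : SG p | f x = 0} := by
    refine Metric.dense_iff.2 fun x ε hε => ?_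
    obtain ⟨m, w, hw⟩ := exists_cellMap_dist_lt x hε
    exact ⟨_, hw (vertex p 0), h m w⟩
  have h1 := (isClosed_eq hf continuous_const).closure_eq.symm.trans hd.closure_eq
  exact h1.ge (mem_univ x)

lemma measure_preimage_contr_le (i : Fin 3) {s : Set (SG p)} (hs : MeasurableSet s) :
    (3 : ENNReal)⁻¹ * selfSimilarMeasure p (contr p i ⁻¹' s) ≤ selfSimilarMeasure p s := by
  conv_rhs => rw [selfSimilarMeasure_eq]
  rw [Measure.smul_apply, Measure.finsetSum_apply, smul_eq_mul,
    ← Measure.map_apply (continuous_contr p i).measurable hs]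
  gcongr
  exact Finset.single_le_sum (f := fun i => (selfSimilarMeasure p).map (contr p i) s)
    (fun _ _ => zero_le) (Finset.mem_univ i)

lemma measure_preimage_cellMap_le (m : ℕ) (w : Fin m → Fin 3) {s : Set (SG p)}
    (hs : MeasurableSet s) :
    (3 : ENNReal)⁻¹ ^ m * selfSimilarMeasure p (cellMap p m w ⁻¹' s) ≤ selfSimilarMeasure p s := by
  induction m generalizing s with
  | zero => simp [cellMap]
  | succ m ih =>
    refine le_trans ?_ (measure_preimage_contr_le (w 0) hs)
    have h := ih (Fin.tail w) ((continuous_contr p (w 0)).measurable hs)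
    rw [pow_succ', mul_assoc]
    gcongr
    exact h

instance : (selfSimilarMeasure p).IsOpenPosMeasure := by
  refine ⟨fun U hU ⟨x, hx⟩ h0 => ?_⟩
  obtain ⟨ε, hε, hball⟩ := Metric.isOpen_iff.1 hU x hx
  obtain ⟨m, w, hw⟩ := exists_cellMap_dist_lt x hε
  have h := measure_preimage_cellMap_le m w hU.measurableSet
  rw [h0, show cellMap p m w ⁻¹' U = univ from eq_univ_of_forall fun y => hball (hw y),
    measure_univ, mul_one] at h
  exact (ENNReal.pow_pos (by simp) m).ne' (le_antisymm h (zero_le))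

/-! ### Graph energies and the harmonic extension rule -/

/-- The values at the vertices of the cell `i` of level one of the harmonic function with the
boundary values `a`. -/
def harmStep (i : Fin 3) (a : Fin 3 → ℝ) (j : Fin 3) : ℝ :=
  if j = i then a i else (a i + a j + (a 0 + a 1 + a 2)) / 5

lemma harmStep_add (i : Fin 3) (a b : Fin 3 → ℝ) (j : Fin 3) :
    harmStep i (fun k => a k + b k) j = harmStep i a j + harmStep i b j := by
  unfold harmStep; split_ifs <;> ring

lemma harmStep_smul (i : Fin 3) (c : ℝ) (a : Fin 3 → ℝ) (j : Fin 3) :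
    harmStep i (fun k => c * a k) j = c * harmStep i a j := by
  unfold harmStep; split_ifs <;> ring

lemma harmStep_const (i : Fin 3) (c : ℝ) (j : Fin 3) : harmStep i (fun _ => c) j = c := by
  unfold harmStep; split_ifs <;> ring

/-- `f` satisfies the harmonic extension rule in every cell. -/
def HarmonicRule (p : Fin 3 → Plane) (f : SG p → ℝ) : Prop :=
  ∀ (m : ℕ) (w : Fin m → Fin 3) (i j : Fin 3), f (cellMap p m w (contr p i (vertex p j))) =
    harmStep i (fun k => f (cellMap p m w (vertex p k))) j

/-- The deviation at the midpoints of `F` from the harmonic extension rule, in energy. -/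
def ruleDefect (p : Fin 3 → Plane) (F : SG p → ℝ) : ℝ :=
  let d := fun i j => F (contr p i (vertex p j)) - harmStep i (fun k => F (vertex p k)) j
  2 * (d 0 1 ^ 2 + d 1 2 ^ 2 + d 0 2 ^ 2) + (d 0 1 - d 1 2) ^ 2 + (d 1 2 - d 0 2) ^ 2
    + (d 0 1 - d 0 2) ^ 2

lemma ruleDefect_nonneg (F : SG p → ℝ) : 0 ≤ ruleDefect p F := by
  unfold ruleDefect; positivity

lemma ruleDefect_eq_zero_iff {F : SG p → ℝ} : ruleDefect p F = 0 ↔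
    ∀ i j, F (contr p i (vertex p j)) = harmStep i (fun k => F (vertex p k)) j := by
  constructor
  · intro h
    have hd : ∀ i j, (F (contr p i (vertex p j)) - harmStep i (fun k => F (vertex p k)) j) ^ 2 ≤
        ruleDefect p F := by
      have hs : ∀ i j, F (contr p i (vertex p j)) - harmStep i (fun k => F (vertex p k)) j =
          F (contr p j (vertex p i)) - harmStep j (fun k => F (vertex p k)) i := by
        intro i j
        rw [contr_vertex_comm]
        unfold harmStep
        by_cases h : i = j
        · simp [h]
        · rw [if_neg h, if_neg (Ne.symm h), add_comm (F (vertex p i))]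
      have hi : ∀ i, F (contr p i (vertex p i)) - harmStep i (fun k => F (vertex p k)) i = 0 := by
        intro i
        simp [harmStep, contr_vertex_self]
      have h01 := hs 1 0
      have h12 := hs 2 1
      have h02 := hs 2 0
      have h0 := hi 0
      have h1 := hi 1
      have h2 := hi 2
      have hQ : ∀ x y z : ℝ, 0 ^ 2 ≤ 2 * (x ^ 2 + y ^ 2 + z ^ 2) + (x - y) ^ 2 + (y - z) ^ 2
            + (x - z) ^ 2 ∧
          x ^ 2 ≤ 2 * (x ^ 2 + y ^ 2 + z ^ 2) + (x - y) ^ 2 + (y - z) ^ 2 + (x - z) ^ 2 ∧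
          y ^ 2 ≤ 2 * (x ^ 2 + y ^ 2 + z ^ 2) + (x - y) ^ 2 + (y - z) ^ 2 + (x - z) ^ 2 ∧
          z ^ 2 ≤ 2 * (x ^ 2 + y ^ 2 + z ^ 2) + (x - y) ^ 2 + (y - z) ^ 2 + (x - z) ^ 2 := by
        intro x y z
        refine ⟨?_, ?_, ?_, ?_⟩ <;>
        linarith [sq_nonneg x, sq_nonneg y, sq_nonneg z, sq_nonneg (x - y), sq_nonneg (y - z),
          sq_nonneg (x - z)]
      obtain ⟨q0, q1, q2, q3⟩ := hQ
        (F (contr p 0 (vertex p 1)) - harmStep 0 (fun k => F (vertex p k)) 1)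
        (F (contr p 1 (vertex p 2)) - harmStep 1 (fun k => F (vertex p k)) 2)
        (F (contr p 0 (vertex p 2)) - harmStep 0 (fun k => F (vertex p k)) 2)
      intro i j
      fin_cases i <;> fin_cases j <;>
        simp only [Fin.zero_eta, Fin.mk_one, Fin.reduceFinMk, h0, h1, h2, h01, h12, h02] <;>
        assumption
    intro i j
    have h1 := hd i j
    rw [h] at h1
    exact sub_eq_zero.1 (pow_eq_zero_iff two_ne_zero |>.1 (le_antisymm h1 (sq_nonneg _)))
  · intro h
    simp [ruleDefect, h]

lemma energy_subdivide (F : SG p → ℝ) :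
    (5 / 3 : ℝ) * ∑ k, ∑ i, (F (contr p k (vertex p i)) - F (contr p k (vertex p (i + 1)))) *
        (F (contr p k (vertex p i)) - F (contr p k (vertex p (i + 1)))) =
      ∑ i, (F (vertex p i) - F (vertex p (i + 1))) * (F (vertex p i) - F (vertex p (i + 1))) +
        (5 / 3) * ruleDefect p F := by
  have h1 : (1 : Fin 3) + 1 = 2 := rfl
  have h2 : (2 : Fin 3) + 1 = 0 := rfl
  have h10 : (1 : Fin 3) ≠ 0 := by decide
  have h21 : (2 : Fin 3) ≠ 1 := by decide
  have h20 : (2 : Fin 3) ≠ 0 := by decide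
  simp only [ruleDefect, harmStep, Fin.sum_univ_three, zero_add, h1, h2, contr_vertex_self,
    contr_vertex_comm 1 0, contr_vertex_comm 2 0, contr_vertex_comm 2 1, if_neg h10, if_neg h21,
    if_neg h20]
  ring

lemma graphEnergy_succ (m : ℕ) (f g : SG p → ℝ) :
    graphEnergy p (m + 1) f g = (5 / 3 : ℝ) ^ m * ∑ w : Fin m → Fin 3, (5 / 3) * ∑ k, ∑ i,
      (f (cellMap p m w (contr p k (vertex p i))) -
          f (cellMap p m w (contr p k (vertex p (i + 1))))) *
        (g (cellMap p m w (contr p k (vertex p i))) -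
          g (cellMap p m w (contr p k (vertex p (i + 1))))) := by
  rw [graphEnergy, ← (Fin.snocEquiv fun _ : Fin (m + 1) => Fin 3).sum_comp,
    Fintype.sum_prod_type, Finset.sum_comm, pow_succ, ← Finset.mul_sum, mul_assoc]
  simp only [Fin.snocEquiv, Equiv.coe_fn_mk, cellMap_snoc]

lemma graphEnergy_succ_self (m : ℕ) (f : SG p → ℝ) :
    graphEnergy p (m + 1) f f = graphEnergy p m f f +
      (5 / 3 : ℝ) ^ (m + 1) * ∑ w : Fin m → Fin 3, ruleDefect p fun x => f (cellMap p m w x) := by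
  have h : ∀ w : Fin m → Fin 3, _ := fun w => energy_subdivide fun x => f (cellMap p m w x)
  rw [graphEnergy_succ, graphEnergy, Finset.sum_congr rfl fun w _ => h w, Finset.sum_add_distrib,
    ← Finset.mul_sum, pow_succ]
  ring

lemma graphEnergy_self_mono (f : SG p → ℝ) : Monotone fun m => graphEnergy p m f f := by
  refine monotone_nat_of_le_succ fun m => ?_
  rw [graphEnergy_succ_self]
  have h : 0 ≤ ∑ w : Fin m → Fin 3, ruleDefect p fun x => f (cellMap p m w x) :=
    Finset.sum_nonneg fun w _ => ruleDefect_nonneg _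
  have h2 : 0 ≤ (5 / 3 : ℝ) ^ (m + 1) *
    ∑ w : Fin m → Fin 3, ruleDefect p fun x => f (cellMap p m w x) := by positivity
  linarith

lemma graphEnergy_self_nonneg (m : ℕ) (f : SG p → ℝ) : 0 ≤ graphEnergy p m f f :=
  mul_nonneg (by positivity)
    (Finset.sum_nonneg fun _ _ => Finset.sum_nonneg fun _ _ => mul_self_nonneg _)

lemma isHarmonic_iff {f : SG p → ℝ} : IsHarmonic p f ↔ Continuous f ∧ HarmonicRule p f := by
  refine and_congr_right fun _ => forall_congr' fun m => ?_
  have h5 : ((5 : ℝ) / 3) ^ (m + 1) ≠ 0 := by positivity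
  rw [graphEnergy_succ_self, left_eq_add, mul_eq_zero, or_iff_right h5,
    Finset.sum_eq_zero_iff_of_nonneg fun w _ => ruleDefect_nonneg _]
  simp only [Finset.mem_univ, true_imp_iff, ruleDefect_eq_zero_iff]

lemma HarmonicRule.eq_zero {f : SG p → ℝ} (hf : HarmonicRule p f) (hc : Continuous f)
    (h0 : ∀ i, f (vertex p i) = 0) (x : SG p) : f x = 0 := by
  have h : ∀ m w j, f (cellMap p m w (vertex p j)) = 0 := by
    intro m
    induction m with
    | zero => exact fun _ j => h0 j
    | succ m ih =>
      intro w j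
      rw [← Fin.snoc_init_self w, cellMap_snoc, hf]
      simp only [ih, harmStep_const]
  exact eq_zero_of_cellMap_vertex hc (fun m w => h m w 0) x

lemma mem_piecewiseHarmonic {m : ℕ} {h : C(SG p, ℝ)} : h ∈ piecewiseHarmonic p m ↔
    ∀ w, HarmonicRule p fun x => h (cellMap p m w x) := by
  refine forall_congr' fun w => ?_
  rw [isHarmonic_iff]
  exact and_iff_right (h.continuous.comp (continuous_cellMap m w))

/-- The space of piecewise harmonic functions of level `m` as a submodule. -/
def piecewiseHarmonicSubmodule (p : Fin 3 → Plane) (m : ℕ) : Submodule ℝ C(SG p, ℝ) where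
  carrier := piecewiseHarmonic p m
  zero_mem' := mem_piecewiseHarmonic.2 fun _ _ _ i j => (harmStep_const i 0 j).symm
  add_mem' := by
    intro f g hf hg
    rw [mem_piecewiseHarmonic] at *
    intro w k v i j
    simp only [ContinuousMap.add_apply, harmStep_add, hf w k v i j, hg w k v i j]
  smul_mem' := by
    intro c f hf
    rw [mem_piecewiseHarmonic] at *
    intro w k v i j
    simp only [ContinuousMap.smul_apply, smul_eq_mul, harmStep_smul, hf w k v i j]

lemma one_mem_piecewiseHarmonic (m : ℕ) : 1 ∈ piecewiseHarmonicSubmodule p m :=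
  mem_piecewiseHarmonic.2 fun _ _ _ i j => (harmStep_const i 1 j).symm

instance (m : ℕ) : FiniteDimensional ℝ (piecewiseHarmonicSubmodule p m) := by
  let ev : piecewiseHarmonicSubmodule p m →ₗ[ℝ] ((Fin m → Fin 3) × Fin 3 → ℝ) :=
    { toFun := fun h q => h.1 (cellMap p m q.1 (vertex p q.2))
      map_add' := fun _ _ => rfl
      map_smul' := fun _ _ => rfl }
  refine FiniteDimensional.of_injective ev ((injective_iff_map_eq_zero ev).2 ?_)
  rintro ⟨h, hh⟩ h0
  refine Subtype.ext (ContinuousMap.ext fun x => ?_)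
  obtain ⟨w, y, rfl⟩ := cellMap_surjective m x
  exact (mem_piecewiseHarmonic.1 hh w).eq_zero (h.continuous.comp (continuous_cellMap m w))
    (fun i => congrFun h0 (w, i)) y

/-! ### The Laplacian and multiharmonic functions -/

lemma graphEnergy_add_left (m : ℕ) (f g v : SG p → ℝ) :
    graphEnergy p m (fun x => f x + g x) v = graphEnergy p m f v + graphEnergy p m g v := by
  simp only [graphEnergy, ← mul_add, ← Finset.sum_add_distrib]
  congr 1
  exact Finset.sum_congr rfl fun _ _ => Finset.sum_congr rfl fun _ _ => by ring

lemma graphEnergy_smul_left (m : ℕ) (c : ℝ) (f v : SG p → ℝ) :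
    graphEnergy p m (fun x => c * f x) v = c * graphEnergy p m f v := by
  simp only [graphEnergy, Finset.mul_sum]
  exact Finset.sum_congr rfl fun _ _ => Finset.sum_congr rfl fun _ _ => by ring

lemma graphEnergy_const_left (m : ℕ) (c : ℝ) (v : SG p → ℝ) :
    graphEnergy p m (fun _ => c) v = 0 := by
  simp [graphEnergy]

lemma graphEnergy_comm (m : ℕ) (f g : SG p → ℝ) : graphEnergy p m f g = graphEnergy p m g f := by
  simp only [graphEnergy, mul_comm]

lemma graphEnergy_add_self_le (m : ℕ) (f g : SG p → ℝ) :
    graphEnergy p m (fun x => f x + g x) (fun x => f x + g x) ≤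
      2 * graphEnergy p m f f + 2 * graphEnergy p m g g := by
  have h := graphEnergy_self_nonneg m (fun x => f x + (-1) * g x)
  rw [graphEnergy_add_left, graphEnergy_smul_left, graphEnergy_comm m f, graphEnergy_comm m g,
    graphEnergy_add_left, graphEnergy_add_left, graphEnergy_smul_left, graphEnergy_smul_left,
    graphEnergy_comm m f g] at h
  rw [graphEnergy_add_left, graphEnergy_comm m f, graphEnergy_comm m g, graphEnergy_add_left,
    graphEnergy_add_left, graphEnergy_comm m f g]
  linarith

lemma FiniteEnergy.add {f g : SG p → ℝ} (hf : FiniteEnergy p f) (hg : FiniteEnergy p g) :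
    FiniteEnergy p fun x => f x + g x := by
  refine ⟨hf.1.add hg.1, ?_⟩
  obtain ⟨A, hA⟩ := hf.2
  obtain ⟨B, hB⟩ := hg.2
  refine ⟨2 * A + 2 * B, ?_⟩
  rintro _ ⟨m, rfl⟩
  refine (graphEnergy_add_self_le m f g).trans ?_
  linarith [hA ⟨m, rfl⟩, hB ⟨m, rfl⟩]

lemma FiniteEnergy.const_mul {f : SG p → ℝ} (hf : FiniteEnergy p f) (c : ℝ) :
    FiniteEnergy p fun x => c * f x := by
  refine ⟨hf.1.const_mul c, ?_⟩
  obtain ⟨A, hA⟩ := hf.2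
  refine ⟨c * (c * A), ?_⟩
  rintro _ ⟨m, rfl⟩
  dsimp only
  rw [graphEnergy_smul_left, graphEnergy_comm, graphEnergy_smul_left, ← mul_assoc, ← mul_assoc]
  exact mul_le_mul_of_nonneg_left (hA ⟨m, rfl⟩) (mul_self_nonneg c)

lemma finiteEnergy_const (c : ℝ) : FiniteEnergy p fun _ => c :=
  ⟨continuous_const, 0, by rintro _ ⟨m, rfl⟩; exact (graphEnergy_const_left m c _).le⟩

lemma hasLaplacian_const (c : ℝ) : HasLaplacian p (fun _ => c) fun _ => 0 := by
  refine ⟨finiteEnergy_const c, continuous_const, fun v _ _ => ?_⟩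
  simp [graphEnergy_const_left]

lemma integrable_of_continuous {f : SG p → ℝ} (hf : Continuous f) :
    Integrable f (selfSimilarMeasure p) :=
  hf.integrable_of_hasCompactSupport (HasCompactSupport.of_compactSpace f)

lemma HasLaplacian.add {f₁ g₁ f₂ g₂ : SG p → ℝ} (h₁ : HasLaplacian p f₁ g₁)
    (h₂ : HasLaplacian p f₂ g₂) :
    HasLaplacian p (fun x => f₁ x + f₂ x) fun x => g₁ x + g₂ x := by
  refine ⟨h₁.1.add h₂.1, h₁.2.1.add h₂.2.1, fun v hv hv0 => ?_⟩
  simp only [graphEnergy_add_left, add_mul]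
  rw [integral_add (f := fun x => g₁ x * v x) (g := fun x => g₂ x * v x)
    (integrable_of_continuous (h₁.2.1.mul hv.1))
    (integrable_of_continuous (h₂.2.1.mul hv.1)), neg_add]
  exact (h₁.2.2 v hv hv0).add (h₂.2.2 v hv hv0)

lemma HasLaplacian.const_mul {f g : SG p → ℝ} (h : HasLaplacian p f g) (c : ℝ) :
    HasLaplacian p (fun x => c * f x) fun x => c * g x := by
  refine ⟨h.1.const_mul c, h.2.1.const_mul c, fun v hv hv0 => ?_⟩
  simp only [graphEnergy_smul_left, mul_assoc]
  rw [integral_const_mul, ← mul_neg]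
  exact (h.2.2 v hv hv0).const_mul c

lemma HasLaplacian.eq_zero {f : SG p → ℝ} (h : HasLaplacian p f fun _ => 0)
    (h0 : ∀ i, f (vertex p i) = 0) (x : SG p) : f x = 0 := by
  have ht := h.2.2 f h.1 h0
  simp only [zero_mul, integral_zero, neg_zero] at ht
  have hE : ∀ m, graphEnergy p m f f = 0 := fun m =>
    le_antisymm ((graphEnergy_self_mono f).ge_of_tendsto ht m) (graphEnergy_self_nonneg m f)
  have hh : IsHarmonic p f := ⟨h.1.1, fun m => by rw [hE, hE]⟩
  exact (isHarmonic_iff.1 hh).2.eq_zero h.1.1 h0 x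

/-- The pairs `(Δ f, f)`. -/
def laplacianGraph (p : Fin 3 → Plane) : Submodule ℝ (C(SG p, ℝ) × C(SG p, ℝ)) where
  carrier := {q | HasLaplacian p q.2 q.1}
  zero_mem' := hasLaplacian_const 0
  add_mem' := fun h₁ h₂ => HasLaplacian.add h₁ h₂
  smul_mem' := fun c _ h => HasLaplacian.const_mul h c

/-- The image of a subspace under a linear relation. -/
def relImage {E F : Type*} [AddCommGroup E] [Module ℝ E] [AddCommGroup F] [Module ℝ F]
    (R : Submodule ℝ (E × F)) (S : Submodule ℝ E) : Submodule ℝ F :=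
  (R ⊓ S.prod ⊤).map (LinearMap.snd ℝ E F)

lemma mem_relImage {E F : Type*} [AddCommGroup E] [Module ℝ E] [AddCommGroup F] [Module ℝ F]
    {R : Submodule ℝ (E × F)} {S : Submodule ℝ E} {u : F} :
    u ∈ relImage R S ↔ ∃ h ∈ S, (h, u) ∈ R := by
  simp only [relImage, Submodule.mem_map, Submodule.mem_inf, Submodule.mem_prod, Prod.exists]
  constructor
  · rintro ⟨a, b, ⟨h1, h2, -⟩, rfl⟩
    exact ⟨a, h2, h1⟩
  · rintro ⟨a, h1, h2⟩
    exact ⟨a, u, ⟨h2, h1, trivial⟩, rfl⟩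

lemma finiteDimensional_relImage {E F : Type*} [AddCommGroup E] [Module ℝ E] [AddCommGroup F]
    [Module ℝ F] (R : Submodule ℝ (E × F)) (S : Submodule ℝ E) [FiniteDimensional ℝ S]
    [FiniteDimensional ℝ (R.comap (LinearMap.inr ℝ E F))] :
    FiniteDimensional ℝ (relImage R S) := by
  have hT : (R ⊓ S.prod ⊤).FG := by
    refine Submodule.fg_of_fg_map_of_fg_inf_ker (LinearMap.fst ℝ E F) ?_ ?_
    · have hle : (R ⊓ S.prod ⊤).map (LinearMap.fst ℝ E F) ≤ S := by
        rintro _ ⟨q, hq, rfl⟩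
        exact hq.2.1
      have := Submodule.finiteDimensional_of_le hle
      exact Module.Finite.iff_fg.1 this
    · have hle : R ⊓ S.prod ⊤ ⊓ (LinearMap.fst ℝ E F).ker ≤
          (R.comap (LinearMap.inr ℝ E F)).map (LinearMap.inr ℝ E F) := by
        rintro ⟨a, b⟩ ⟨⟨h1, -⟩, h2⟩
        obtain rfl : a = 0 := h2
        exact ⟨b, h1, rfl⟩
      have := Submodule.finiteDimensional_of_le hle
      exact Module.Finite.iff_fg.1 this
  exact Module.Finite.iff_fg.2 (hT.map _)

instance : FiniteDimensional ℝ ((laplacianGraph p).comap (LinearMap.inr ℝ _ _)) := by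
  let ev : (laplacianGraph p).comap (LinearMap.inr ℝ _ _) →ₗ[ℝ] (Fin 3 → ℝ) :=
    { toFun := fun h i => h.1 (vertex p i)
      map_add' := fun _ _ => rfl
      map_smul' := fun _ _ => rfl }
  refine FiniteDimensional.of_injective ev ((injective_iff_map_eq_zero ev).2 ?_)
  rintro ⟨h, hh⟩ h0
  exact Subtype.ext (ContinuousMap.ext fun x => HasLaplacian.eq_zero hh (congrFun h0) x)

/-- The multiharmonic functions of order `n` are a finite-dimensional space containing the
constants. -/
lemma exists_submodule_multiharmonic (n : ℕ) : ∃ S : Submodule ℝ C(SG p, ℝ),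
    FiniteDimensional ℝ S ∧ 1 ∈ S ∧ (S : Set C(SG p, ℝ)) = multiharmonic p n := by
  induction n with
  | zero =>
    refine ⟨(laplacianGraph p).comap (LinearMap.inr ℝ _ _), inferInstance, hasLaplacian_const 1,
      rfl⟩
  | succ n ih =>
    obtain ⟨S, hfd, -, hS⟩ := ih
    refine ⟨relImage (laplacianGraph p) S, finiteDimensional_relImage _ _,
      mem_relImage.2 ⟨0, zero_mem S, hasLaplacian_const 1⟩, ?_⟩
    ext f
    rw [SetLike.mem_coe, mem_relImage]
    constructor
    · rintro ⟨g, hg, h⟩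
      exact ⟨g, h, hS.le hg⟩
    · rintro ⟨g, h, hg⟩
      exact ⟨⟨g, h.2.1⟩, hS.ge hg, h⟩

/-! ### Existence of harmonic functions -/

lemma abs_harmStep_sub_le {a : Fin 3 → ℝ} {c : ℝ} (h : ∀ j k, |a j - a k| ≤ c) (i : Fin 3) :
    ∀ j k, |harmStep i a j - harmStep i a k| ≤ 3 / 5 * c := by
  have hc : 0 ≤ c := (abs_nonneg _).trans (h 0 0)
  have h' : ∀ j k, a j - a k ≤ c := fun j k => (le_abs_self _).trans (h j k)
  have key : ∀ j k, harmStep i a j - harmStep i a k ≤ 3 / 5 * c := by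
    intro j k
    have h01 := h' 0 1
    have h02 := h' 0 2
    have h12 := h' 1 2
    have h10 := h' 1 0
    have h20 := h' 2 0
    have h21 := h' 2 1
    unfold harmStep
    fin_cases i <;> fin_cases j <;> fin_cases k <;>
      simp <;> linarith
  exact fun j k => abs_sub_le_iff.2 ⟨key j k, key k j⟩

lemma abs_harmStep_sub_le' {a : Fin 3 → ℝ} {c : ℝ} (h : ∀ j k, |a j - a k| ≤ c) (i j k : Fin 3) :
    |harmStep i a j - a k| ≤ 2 * c := by
  have h1 := abs_harmStep_sub_le h i j i
  have hc : 0 ≤ c := (abs_nonneg _).trans (h 0 0)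
  have h2 : harmStep i a i = a i := if_pos rfl
  rw [h2] at h1
  have h3 := abs_sub_le (harmStep i a j) (a i) (a k)
  linarith [h i k]

/-- The boundary values on the cell `ω 0 ⋯ ω (n - 1)` of the harmonic function with the boundary
values `a`. -/
def harmIter : ℕ → (Fin 3 → ℝ) → (ℕ → Fin 3) → Fin 3 → ℝ
  | 0, a, _ => a
  | n + 1, a, ω => harmIter n (harmStep (ω 0) a) fun k => ω (k + 1)

lemma abs_harmIter_succ_sub_le (n : ℕ) {a : Fin 3 → ℝ} {c : ℝ} (h : ∀ j k, |a j - a k| ≤ c)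
    (ω : ℕ → Fin 3) :
    |harmIter (n + 1) a ω 0 - harmIter n a ω 0| ≤ (3 / 5) ^ n * (2 * c) := by
  induction n generalizing a c ω with
  | zero => simpa [harmIter] using abs_harmStep_sub_le' h (ω 0) 0 0
  | succ n ih =>
    refine (ih (abs_harmStep_sub_le h (ω 0)) fun k => ω (k + 1)).trans (le_of_eq ?_)
    ring

lemma continuous_harmStep (i j : Fin 3) : Continuous fun a : Fin 3 → ℝ => harmStep i a j := by
  unfold harmStep
  split_ifs <;> fun_prop

lemma continuous_harmIter (n : ℕ) (j : Fin 3) :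
    Continuous fun q : (Fin 3 → ℝ) × (ℕ → Fin 3) => harmIter n q.1 q.2 j := by
  induction n with
  | zero => exact (continuous_apply j).comp continuous_fst
  | succ n ih =>
    have h1 : Continuous fun q : Fin 3 × (Fin 3 → ℝ) => harmStep q.1 q.2 :=
      continuous_prod_of_discrete_left.2 fun i => continuous_pi fun j => continuous_harmStep i j
    have h2 : Continuous fun q : (Fin 3 → ℝ) × (ℕ → Fin 3) => (q.2 0, q.1) := by fun_prop
    have h3 : Continuous fun q : (Fin 3 → ℝ) × (ℕ → Fin 3) => fun k => q.2 (k + 1) := by fun_prop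
    exact ih.comp ((h1.comp h2).prodMk h3)

lemma exists_osc_bound (a : Fin 3 → ℝ) : ∃ c, ∀ j k, |a j - a k| ≤ c := by
  refine ⟨∑ j, |a j| + ∑ k, |a k|, fun j k => (abs_sub _ _).trans (add_le_add ?_ ?_)⟩ <;>
  exact Finset.single_le_sum (f := fun j => |a j|) (fun _ _ => abs_nonneg _) (Finset.mem_univ _)

lemma summable_harmBound (c : ℝ) : Summable fun n : ℕ => (3 / 5 : ℝ) ^ n * c :=
  (summable_geometric_of_lt_one (by norm_num) (by norm_num)).mul_right c

lemma summable_harmIter (a : Fin 3 → ℝ) (ω : ℕ → Fin 3) :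
    Summable fun n => harmIter (n + 1) a ω 0 - harmIter n a ω 0 := by
  obtain ⟨c, hc⟩ := exists_osc_bound a
  exact Summable.of_norm_bounded (summable_harmBound _) fun n => abs_harmIter_succ_sub_le n hc ω

/-- The value at the point with address `ω` of the harmonic function with boundary values `a`. -/
def harmCode (a : Fin 3 → ℝ) (ω : ℕ → Fin 3) : ℝ :=
  a 0 + ∑' n, (harmIter (n + 1) a ω 0 - harmIter n a ω 0)

lemma continuous_harmCode (a : Fin 3 → ℝ) : Continuous (harmCode a) := by
  obtain ⟨c, hc⟩ := exists_osc_bound a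
  refine continuous_const.add (continuous_tsum (fun n => ?_) (summable_harmBound (2 * c))
    fun n ω => abs_harmIter_succ_sub_le n hc ω)
  have h : Continuous fun ω : ℕ → Fin 3 => (a, ω) := by fun_prop
  exact ((continuous_harmIter (n + 1) 0).comp h).sub ((continuous_harmIter n 0).comp h)

lemma harmCode_eq (a : Fin 3 → ℝ) (ω : ℕ → Fin 3) :
    harmCode a ω = harmCode (harmStep (ω 0) a) fun k => ω (k + 1) := by
  rw [harmCode, (summable_harmIter a ω).tsum_eq_zero_add, harmCode]
  simp only [harmIter]
  ring

lemma abs_harmCode_sub_le {a : Fin 3 → ℝ} {c : ℝ} (h : ∀ j k, |a j - a k| ≤ c) (ω : ℕ → Fin 3)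
    (j : Fin 3) : |harmCode a ω - a j| ≤ 6 * c := by
  have h1 : |∑' n, (harmIter (n + 1) a ω 0 - harmIter n a ω 0)| ≤ 5 * c := by
    have h2 := tsum_of_norm_bounded (f := fun n => harmIter (n + 1) a ω 0 - harmIter n a ω 0)
      (summable_harmBound (2 * c)).hasSum
      fun n => abs_harmIter_succ_sub_le n h ω
    rw [tsum_mul_right, tsum_geometric_of_lt_one (by norm_num) (by norm_num)] at h2
    refine h2.trans (le_of_eq ?_)
    ring
  have h3 := abs_add_le (a 0 - a j) (∑' n, (harmIter (n + 1) a ω 0 - harmIter n a ω 0))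
  rw [harmCode, add_sub_right_comm]
  linarith [h 0 j]

lemma le_zero_of_le_geometric {x c : ℝ} (h : ∀ n : ℕ, x ≤ (3 / 5) ^ n * c) : x ≤ 0 := by
  have ht : Tendsto (fun n : ℕ => (3 / 5 : ℝ) ^ n * c) atTop (𝓝 0) := by
    simpa using (tendsto_pow_atTop_nhds_zero_of_lt_one (r := (3 / 5 : ℝ))
      (by norm_num) (by norm_num)).mul_const c
  exact ge_of_tendsto' ht h

lemma harmCode_vertex (hp : IsEquilateral p) (a : Fin 3 → ℝ) {ω : ℕ → Fin 3} {j : Fin 3}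
    (hω : address p ω = vertex p j) : harmCode a ω = a j := by
  have key : ∀ n : ℕ, ∀ (a : Fin 3 → ℝ) (c : ℝ), (∀ j k, |a j - a k| ≤ c) → ∀ ω,
      address p ω = vertex p j → |harmCode a ω - a j| ≤ (3 / 5) ^ n * (6 * c) := by
    intro n
    induction n with
    | zero => intro a c hc ω _; simpa using abs_harmCode_sub_le hc ω j
    | succ n ih =>
      intro a c hc ω hω
      rw [← consAddr_eta ω, ← contr_address] at hω
      obtain ⟨h0, h1⟩ := eq_of_contr_eq_vertex hp hω
      have h2 := ih _ _ (abs_harmStep_sub_le hc (ω 0)) _ h1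
      rw [← harmCode_eq, ← h0, harmStep, if_pos rfl, h0] at h2
      refine h2.trans (le_of_eq ?_)
      ring
  obtain ⟨c, hc⟩ := exists_osc_bound a
  exact sub_eq_zero.1 (abs_eq_zero.1 (le_antisymm
    (le_zero_of_le_geometric fun n => key n a c hc ω hω) (abs_nonneg _)))

lemma harmCode_congr (hp : IsEquilateral p) (a : Fin 3 → ℝ) {ω ω' : ℕ → Fin 3}
    (hω : address p ω = address p ω') : harmCode a ω = harmCode a ω' := by
  have key : ∀ n : ℕ, ∀ (a : Fin 3 → ℝ) (c : ℝ), (∀ j k, |a j - a k| ≤ c) → ∀ ω ω',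
      address p ω = address p ω' → |harmCode a ω - harmCode a ω'| ≤ (3 / 5) ^ n * (12 * c) := by
    intro n
    induction n with
    | zero =>
      intro a c hc ω ω' _
      have h1 := abs_harmCode_sub_le hc ω 0
      have h2 := abs_harmCode_sub_le hc ω' 0
      rw [abs_sub_comm] at h2
      have h3 := abs_sub_le (harmCode a ω) (a 0) (harmCode a ω')
      rw [pow_zero]
      linarith
    | succ n ih =>
      intro a c hc ω ω' h
      have hc0 : 0 ≤ c := (abs_nonneg _).trans (hc 0 0)
      rw [← consAddr_eta ω, ← consAddr_eta ω', ← contr_address, ← contr_address] at h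
      by_cases h0 : ω 0 = ω' 0
      · rw [h0] at h
        have h2 := ih _ _ (abs_harmStep_sub_le hc (ω 0)) _ _ (contr_injective _ h)
        rw [← harmCode_eq, h0, ← harmCode_eq] at h2
        refine h2.trans (le_of_eq ?_)
        ring
      · obtain ⟨h1, h2⟩ := eq_vertex_of_contr_eq hp h0 h
        rw [harmCode_eq a ω, harmCode_eq a ω', harmCode_vertex hp _ h1, harmCode_vertex hp _ h2,
          harmStep, harmStep, if_neg h0, if_neg (Ne.symm h0), add_comm (a (ω 0)), sub_self,
          abs_zero]
        positivity
  obtain ⟨c, hc⟩ := exists_osc_bound a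
  exact sub_eq_zero.1 (abs_eq_zero.1 (le_antisymm
    (le_zero_of_le_geometric fun n => key n a c hc ω ω' hω) (abs_nonneg _)))

lemma exists_harmonic (hp : IsEquilateral p) : ∃ ψ : (Fin 3 → ℝ) → C(SG p, ℝ),
    (∀ a j, ψ a (vertex p j) = a j) ∧ (∀ a, HarmonicRule p (ψ a)) ∧
    ∀ a c, (∀ j k, |a j - a k| ≤ c) → ∀ x j, |ψ a x - a j| ≤ 6 * c := by
  have hq : IsQuotientMap (⟨address p, continuous_address p⟩ : C(ℕ → Fin 3, SG p)) :=
    IsQuotientMap.of_surjective_continuous address_surjective (continuous_address p)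
  let ψ : (Fin 3 → ℝ) → C(SG p, ℝ) := fun a =>
    hq.lift ⟨harmCode a, continuous_harmCode a⟩ fun _ _ h => harmCode_congr hp a h
  have hψ : ∀ a ω, ψ a (address p ω) = harmCode a ω := fun a ω =>
    DFunLike.congr_fun (hq.lift_comp ⟨harmCode a, continuous_harmCode a⟩
      fun _ _ h => harmCode_congr hp a h) ω
  have hv : ∀ a j, ψ a (vertex p j) = a j := fun a j => by
    rw [← address_const, hψ, harmCode_vertex hp a (address_const j)]
  have hc : ∀ a i x, ψ a (contr p i x) = ψ (harmStep i a) x := fun a i x => by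
    obtain ⟨ω, rfl⟩ := address_surjective x
    rw [contr_address, hψ, hψ, harmCode_eq]
    rfl
  refine ⟨ψ, hv, fun a m w => ?_, fun a c h x j => ?_⟩
  · induction m generalizing a with
    | zero =>
      intro i j
      simp only [cellMap, hc, hv]
    | succ m ih =>
      intro i j
      simp only [cellMap, hc]
      exact ih (harmStep (w 0) a) (Fin.tail w) i j
  · obtain ⟨ω, rfl⟩ := address_surjective x
    rw [hψ]
    exact abs_harmCode_sub_le h ω j

/-- Continuous functions are uniform limits of their piecewise harmonic interpolants. -/
lemma exists_piecewiseHarmonic_near (hp : IsEquilateral p) (h : C(SG p, ℝ)) {ε : ℝ} (hε : 0 < ε) :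
    ∃ M : ℕ, ∀ m, M ≤ m → ∃ g ∈ piecewiseHarmonicSubmodule p m, ‖g - h‖ ≤ ε := by
  obtain ⟨ψ, hv, hh, hb⟩ := exists_harmonic hp
  obtain ⟨δ, hδ, hu⟩ := Metric.uniformContinuous_iff.1
    (CompactSpace.uniformContinuous_of_continuous h.continuous) (ε / 7) (by positivity)
  obtain ⟨M, hM⟩ := exists_dist_cellMap_lt (p := p) hδ
  refine ⟨M, fun m hm => ?_⟩
  have hosc : ∀ (w : Fin m → Fin 3) x y, |h (cellMap p m w x) - h (cellMap p m w y)| ≤ ε / 7 :=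
    fun w x y => (hu (hM m hm w x y)).le
  obtain ⟨g, hg⟩ := exists_glue m (fun w => ψ fun k => h (cellMap p m w (vertex p k))) (by
    intro v w x y hxy
    rcases eq_or_vertex_of_cellMap_eq hp hxy with ⟨rfl, rfl⟩ | ⟨i, j, rfl, rfl⟩
    · rfl
    · rw [hv, hv, hxy])
  refine ⟨g, mem_piecewiseHarmonic.2 fun w => ?_, (ContinuousMap.norm_le _ hε.le).2 fun x => ?_⟩
  · simp only [hg]
    exact hh _
  · obtain ⟨w, y, rfl⟩ := cellMap_surjective m x
    rw [ContinuousMap.sub_apply, hg, Real.norm_eq_abs]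
    have h1 := hb _ _ (fun j k => hosc w (vertex p j) (vertex p k)) y 0
    have h2 := hosc w (vertex p 0) y
    exact (abs_sub_le _ (h (cellMap p m w (vertex p 0))) _).trans (by linarith)

/-! ### Fractal functions -/

/-- The pairs `(h, h^α)`. -/
def fractalGraph (p : Fin 3 → Plane) {N : ℕ} (α : (Fin N → Fin 3) → C(SG p, ℝ))
    (L : C(SG p, ℝ) →L[ℝ] C(SG p, ℝ)) : Submodule ℝ (C(SG p, ℝ) × C(SG p, ℝ)) where
  carrier := {q | IsFractalFunction p α L q.1 q.2}
  zero_mem' := by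
    intro w t
    simp
  add_mem' := by
    intro q r hq hr w t
    have h1 := hq w t
    have h2 := hr w t
    simp only [Prod.fst_add, Prod.snd_add, map_add, ContinuousMap.add_apply, h1, h2]
    ring
  smul_mem' := by
    intro c q hq w t
    have h1 := hq w t
    simp only [Prod.smul_fst, Prod.smul_snd, map_smul, ContinuousMap.smul_apply, smul_eq_mul, h1]
    ring

variable {N : ℕ} {α : (Fin N → Fin 3) → C(SG p, ℝ)} {L : C(SG p, ℝ) →L[ℝ] C(SG p, ℝ)}

lemma norm_le_of_cellMap {u : C(SG p, ℝ)} {C : ℝ} (hC : 0 ≤ C)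
    (h : ∀ (w : Fin N → Fin 3) t, |u (cellMap p N w t)| ≤ C) : ‖u‖ ≤ C := by
  refine (ContinuousMap.norm_le _ hC).2 fun x => ?_
  obtain ⟨w, t, rfl⟩ := cellMap_surjective N x
  exact h w t

lemma IsFractalFunction.norm_le {h u : C(SG p, ℝ)} (hu : IsFractalFunction p α L h u) {r : ℝ}
    (hr : ∀ w, ‖α w‖ ≤ r) : (1 - r) * ‖u‖ ≤ (1 + r * ‖L‖) * ‖h‖ := by
  have hr0 : 0 ≤ r := (norm_nonneg _).trans (hr fun _ => 0)
  have key : ‖u‖ ≤ ‖h‖ + r * (‖u‖ + ‖L‖ * ‖h‖) := by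
    refine norm_le_of_cellMap (N := N) (by positivity) fun w t => ?_
    rw [hu w t]
    refine (abs_add_le _ _).trans (add_le_add (h.norm_coe_le_norm _) ?_)
    rw [abs_mul]
    refine mul_le_mul (((α w).norm_coe_le_norm t).trans (hr w)) ?_ (abs_nonneg _) hr0
    exact (abs_sub _ _).trans (add_le_add (u.norm_coe_le_norm t)
      (((L h).norm_coe_le_norm t).trans (L.le_opNorm h)))
  linarith

lemma finiteDimensional_fractal (hα : ∀ w, ‖α w‖ < 1) (S : Submodule ℝ C(SG p, ℝ))
    [FiniteDimensional ℝ S] : FiniteDimensional ℝ (relImage (fractalGraph p α L) S) := by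
  obtain ⟨w₀, hw₀⟩ := Finite.exists_max fun w => ‖α w‖
  have hker : (fractalGraph p α L).comap (LinearMap.inr ℝ _ _) = ⊥ := by
    refine (Submodule.eq_bot_iff _).2 fun u hu => ?_
    have h := IsFractalFunction.norm_le (h := 0) hu hw₀
    rw [norm_zero, mul_zero] at h
    exact norm_le_zero_iff.1 (nonpos_of_mul_nonpos_right h (sub_pos.2 (hα w₀)))
  have : FiniteDimensional ℝ ((fractalGraph p α L).comap (LinearMap.inr ℝ _ _)) := by
    rw [hker]; infer_instance
  exact finiteDimensional_relImage _ _

lemma coe_relImage_fractalGraph (S : Submodule ℝ C(SG p, ℝ)) :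
    (relImage (fractalGraph p α L) S : Set C(SG p, ℝ)) = fractalClass p α L S := by
  ext u
  exact mem_relImage

/-- The continuous functions that vanish on the boundary. -/
def vanishing (p : Fin 3 → Plane) : Submodule ℝ C(SG p, ℝ) where
  carrier := {d | ∀ i, d (vertex p i) = 0}
  zero_mem' := fun _ => rfl
  add_mem' := fun {f g} hf hg i => by simp [hf i, hg i]
  smul_mem' := fun c f hf i => by simp [hf i]

/-- The space of continuous functions that vanish on the boundary, with the supremum norm. -/
def Vanishing (p : Fin 3 → Plane) : Type := vanishing p

instance : NormedAddCommGroup (Vanishing p) := inferInstanceAs (NormedAddCommGroup (vanishing p))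

instance : NormedSpace ℝ (Vanishing p) := inferInstanceAs (NormedSpace ℝ (vanishing p))

instance : CompleteSpace (Vanishing p) := by
  have h : IsClosed (vanishing p : Set C(SG p, ℝ)) := by
    have h1 : (vanishing p : Set C(SG p, ℝ)) = ⋂ i, {d | d (vertex p i) = 0} := by
      ext d
      simp only [mem_iInter]
      rfl
    rw [h1]
    exact isClosed_iInter fun i => isClosed_eq (continuous_eval_const _) continuous_const
  exact h.completeSpace_coe

/-- The operator `d ↦ A d` with `(A d) (L_w t) = α_w (t) d (t)`. -/
lemma exists_cellMul (hp : IsEquilateral p) {r : ℝ} (hr : ∀ w, ‖α w‖ ≤ r) :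
    ∃ A : Vanishing p →L[ℝ] Vanishing p, ‖A‖ ≤ r ∧
      ∀ d w t, (A d).1 (cellMap p N w t) = α w t * d.1 t := by
  have hr0 : 0 ≤ r := (norm_nonneg _).trans (hr fun _ => 0)
  have hex : ∀ d : Vanishing p, ∃ u : C(SG p, ℝ), ∀ w t,
      u (cellMap p N w t) = α w t * d.1 t := by
    intro d
    refine exists_glue N (fun w => α w * d.1) fun v w x y h => ?_
    rcases eq_or_vertex_of_cellMap_eq hp h with ⟨rfl, rfl⟩ | ⟨i, j, rfl, rfl⟩
    · rfl
    · simp [d.2 i, d.2 j]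
  choose A hA using hex
  have hmem : ∀ d, A d ∈ vanishing p := fun d i => by
    rw [← cellMap_const_vertex N i, hA, d.2 i, mul_zero]
  have hext : ∀ u v : C(SG p, ℝ),
      (∀ (w : Fin N → Fin 3) t, u (cellMap p N w t) = v (cellMap p N w t)) → u = v := by
    intro u v h
    ext x
    obtain ⟨w, t, rfl⟩ := cellMap_surjective N x
    exact h w t
  let A' : Vanishing p →ₗ[ℝ] Vanishing p :=
    { toFun := fun d => ⟨A d, hmem d⟩
      map_add' := fun d e => Subtype.ext (hext _ _ fun w t => by
        change A (d + e) _ = A d _ + A e _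
        rw [hA, hA, hA]
        exact mul_add _ _ _)
      map_smul' := fun c d => Subtype.ext (hext _ _ fun w t => by
        change A (c • d) _ = c * A d _
        rw [hA, hA]
        exact mul_left_comm _ _ _) }
  have hb : ∀ d, ‖A' d‖ ≤ r * ‖d‖ := fun d => by
    refine norm_le_of_cellMap (u := A d) (N := N) (by positivity) fun w t => ?_
    rw [hA, abs_mul]
    exact mul_le_mul (((α w).norm_coe_le_norm t).trans (hr w))
      (d.1.norm_coe_le_norm t) (abs_nonneg _) hr0
  exact ⟨A'.mkContinuous r hb, A'.mkContinuous_norm_le hr0 hb, fun d w t => hA d w t⟩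

lemma exists_eq_add_of_norm_lt_one {E : Type*} [NormedAddCommGroup E] [NormedSpace ℝ E]
    [CompleteSpace E] {B : E →L[ℝ] E} (hB : ‖B‖ < 1) (y : E) : ∃ x, x = y + B x := by
  refine ⟨(↑(Units.oneSub B hB)⁻¹ : E →L[ℝ] E) y, ?_⟩
  have h : ((Units.oneSub B hB : E →L[ℝ] E) * (↑(Units.oneSub B hB)⁻¹ : E →L[ℝ] E)) y = y := by
    rw [Units.mul_inv]; rfl
  rw [Units.val_oneSub] at h
  exact sub_eq_iff_eq_add.1 h

/-- Every continuous function has a fractal function. -/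
lemma exists_isFractalFunction (hp : IsEquilateral p) (hα : ∀ w, ‖α w‖ < 1)
    (hL : ∀ (g : C(SG p, ℝ)) (i : Fin 3), L g (vertex p i) = g (vertex p i)) (h : C(SG p, ℝ)) :
    ∃ u, IsFractalFunction p α L h u := by
  obtain ⟨w₀, hw₀⟩ := Finite.exists_max fun w => ‖α w‖
  obtain ⟨A, hAn, hA⟩ := exists_cellMul hp hw₀
  let k : Vanishing p := ⟨h - L h, fun i => by simp [hL]⟩
  obtain ⟨e, he⟩ := exists_eq_add_of_norm_lt_one (hAn.trans_lt (hα w₀)) (A k)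
  refine ⟨h + e.1, fun w t => ?_⟩
  have h1 : e.1 (cellMap p N w t) = (A k).1 (cellMap p N w t) + (A e).1 (cellMap p N w t) :=
    DFunLike.congr_fun (congrArg Subtype.val he) (cellMap p N w t)
  rw [hA, hA] at h1
  rw [ContinuousMap.add_apply, h1]
  simp only [k, ContinuousMap.sub_apply, ContinuousMap.add_apply]
  ring

/-- The constant function `1` is a fractal function if the scaling functions are small. -/
lemma exists_isFractalFunction_one (hp : IsEquilateral p)
    (hL : ∀ (g : C(SG p, ℝ)) (i : Fin 3), L g (vertex p i) = g (vertex p i))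
    (hαL : ∀ w, ‖α w‖ * ‖L‖ < 1) : ∃ h, IsFractalFunction p α L h 1 := by
  obtain ⟨w₀, hw₀⟩ := Finite.exists_max fun w => ‖α w‖
  obtain ⟨A, hAn, hA⟩ := exists_cellMul hp hw₀
  let k : Vanishing p := ⟨1 - L 1, fun i => by simp [hL]⟩
  have hLm : ∀ d : Vanishing p, L d.1 ∈ vanishing p := fun d i => (hL d.1 i).trans (d.2 i)
  let L₀ : Vanishing p →ₗ[ℝ] Vanishing p :=
    { toFun := fun d => ⟨L d.1, hLm d⟩
      map_add' := fun d e => Subtype.ext (map_add L d.1 e.1)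
      map_smul' := fun c d => Subtype.ext (map_smul L c d.1) }
  have hL₀ : ∀ d, ‖L₀ d‖ ≤ ‖L‖ * ‖d‖ := fun d => L.le_opNorm d.1
  let L' : Vanishing p →L[ℝ] Vanishing p := L₀.mkContinuous ‖L‖ hL₀
  have hL' : ‖L'‖ ≤ ‖L‖ := L₀.mkContinuous_norm_le (norm_nonneg L) hL₀
  have hB : ‖A.comp L'‖ < 1 := by
    refine lt_of_le_of_lt ?_ (hαL w₀)
    exact (A.opNorm_comp_le L').trans (mul_le_mul hAn hL' (norm_nonneg _) (norm_nonneg _))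
  obtain ⟨d, hd⟩ := exists_eq_add_of_norm_lt_one hB (A k)
  refine ⟨1 - d.1, fun w t => ?_⟩
  have h1 : d.1 (cellMap p N w t) = (A k).1 (cellMap p N w t) + (A (L' d)).1 (cellMap p N w t) :=
    DFunLike.congr_fun (congrArg Subtype.val hd) (cellMap p N w t)
  rw [hA, hA] at h1
  rw [ContinuousMap.sub_apply, h1, map_sub]
  change 1 = 1 - (α w t * (1 - L 1 t) + α w t * L d.1 t) + α w t * (1 - (L 1 t - L d.1 t))
  ring

/-- On all sufficiently fine levels there is a positive fractal piecewise harmonic function. -/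
lemma exists_pos_fractal_piecewiseHarmonic (hp : IsEquilateral p) (hα : ∀ w, ‖α w‖ < 1)
    (hL : ∀ (g : C(SG p, ℝ)) (i : Fin 3), L g (vertex p i) = g (vertex p i))
    (hαL : ∀ w, ‖α w‖ * ‖L‖ < 1) :
    ∃ M : ℕ, ∀ m, M ≤ m →
      ∃ u ∈ relImage (fractalGraph p α L) (piecewiseHarmonicSubmodule p m), ∀ t, 1 / 2 ≤ u t := by
  obtain ⟨w₀, hw₀⟩ := Finite.exists_max fun w => ‖α w‖
  obtain ⟨h, hh⟩ := exists_isFractalFunction_one hp hL hαL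
  have hr := sub_pos.2 (hα w₀)
  have hD : 0 < 1 + ‖α w₀‖ * ‖L‖ := by positivity
  obtain ⟨M, hM⟩ := exists_piecewiseHarmonic_near hp h
    (show 0 < (1 - ‖α w₀‖) / (2 * (1 + ‖α w₀‖ * ‖L‖)) by positivity)
  refine ⟨M, fun m hm => ?_⟩
  obtain ⟨g, hg, hgh⟩ := hM m hm
  obtain ⟨u, hu⟩ := exists_isFractalFunction hp hα hL g
  refine ⟨u, mem_relImage.2 ⟨g, hg, hu⟩, fun t => ?_⟩
  have hsub : IsFractalFunction p α L (g - h) (u - 1) :=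
    (fractalGraph p α L).sub_mem (x := (g, u)) (y := (h, 1)) hu hh
  have h1 := hsub.norm_le hw₀
  have h2 : (1 + ‖α w₀‖ * ‖L‖) * ‖g - h‖ ≤ (1 - ‖α w₀‖) * (1 / 2) := by
    refine (mul_le_mul_of_nonneg_left hgh hD.le).trans (le_of_eq ?_)
    field_simp
  have h3 : ‖u - 1‖ ≤ 1 / 2 := le_of_mul_le_mul_left (h1.trans h2) hr
  have h4 := abs_le.1 (((u - 1).norm_coe_le_norm t).trans h3)
  rw [ContinuousMap.sub_apply, ContinuousMap.one_apply] at h4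
  linarith [h4.1]

/-! ### Best one-sided approximation -/

/-- A finite-dimensional space of continuous functions with a member below `f` has a best one-sided
approximant from below to `f`. -/
lemma exists_isBestFromBelow (W : Submodule ℝ C(SG p, ℝ)) [FiniteDimensional ℝ W] {f : SG p → ℝ}
    (hf : Integrable f (selfSimilarMeasure p)) (hne : (below p W f).Nonempty) :
    ∃ u, IsBestFromBelow p W f u := by
  obtain ⟨u₀, hu₀, hle₀⟩ := hne
  let b := Module.finBasis ℝ W
  let ι : (Fin (Module.finrank ℝ W) → ℝ) →ₗ[ℝ] C(SG p, ℝ) :=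
    W.subtype ∘ₗ b.equivFun.symm.toLinearMap
  have hι : Function.Injective ι := Subtype.val_injective.comp b.equivFun.symm.injective
  have hιW : ∀ c, ι c ∈ W := fun c => (b.equivFun.symm c).2
  have hWι : ∀ u ∈ W, ∃ c, ι c = u := fun u hu =>
    ⟨b.equivFun ⟨u, hu⟩, congrArg Subtype.val (b.equivFun.symm_apply_apply ⟨u, hu⟩)⟩
  have hιc : Continuous ι := ι.continuous_of_finiteDimensional
  let T : (Fin (Module.finrank ℝ W) → ℝ) →ₗ[ℝ] Lp ℝ 1 (selfSimilarMeasure p) :=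
    (ContinuousMap.toLp 1 (selfSimilarMeasure p) ℝ : C(SG p, ℝ) →L[ℝ] _).toLinearMap ∘ₗ ι
  have hT : T.ker = ⊥ := LinearMap.ker_eq_bot.2
    ((ContinuousMap.toLp_injective (p := 1) (𝕜 := ℝ) (selfSimilarMeasure p)).comp hι)
  obtain ⟨K, -, hK⟩ := T.exists_antilipschitzWith hT
  have hTn : ∀ u, ‖T u‖ = ∫ t, |ι u t| ∂(selfSimilarMeasure p) := fun u => by
    rw [L1.norm_eq_integral_norm]
    exact integral_congr_ae ((ContinuousMap.coeFn_toLp (p := 1) (𝕜 := ℝ) (selfSimilarMeasure p)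
      (ι u)).fun_comp norm)
  have hTi : ∀ u, ∫ t, T u t ∂(selfSimilarMeasure p) =
      ∫ t, ι u t ∂(selfSimilarMeasure p) := fun u =>
    integral_congr_ae (ContinuousMap.coeFn_toLp (p := 1) (𝕜 := ℝ) (selfSimilarMeasure p)
      (ι u))
  have hcont : Continuous fun u => ∫ t, ι u t ∂(selfSimilarMeasure p) := by
    simp only [← hTi]
    exact continuous_integral.comp T.continuous_of_finiteDimensional
  let B : Set (Fin (Module.finrank ℝ W) → ℝ) := {u | (∀ t, ι u t ≤ f t) ∧
    ∫ t, u₀ t ∂(selfSimilarMeasure p) ≤ ∫ t, ι u t ∂(selfSimilarMeasure p)}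
  have hBc : IsClosed B := by
    refine IsClosed.inter (s₁ := {u | ∀ t, ι u t ≤ f t}) ?_
      (isClosed_le continuous_const hcont)
    simp only [ofPred_forall]
    exact isClosed_iInter fun t => isClosed_le
      ((continuous_eval_const t).comp hιc) continuous_const
  have hBb : Bornology.IsBounded B := by
    refine (isBounded_iff_forall_norm_le).2 ⟨K * (∫ t, |f t| ∂(selfSimilarMeasure p) +
      (∫ t, f t ∂(selfSimilarMeasure p) - ∫ t, u₀ t ∂(selfSimilarMeasure p))), ?_⟩
    rintro u ⟨hu1, hu2⟩
    have hui := integrable_of_continuous (ι u).continuous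
    have h1 : ‖u‖ ≤ K * ‖T u‖ := by simpa using hK.le_mul_dist u 0
    refine h1.trans (mul_le_mul_of_nonneg_left ?_ K.2)
    rw [hTn]
    have h2 : ∫ t, |ι u t| ∂(selfSimilarMeasure p) ≤
        ∫ t, (|f t| + (f t - ι u t)) ∂(selfSimilarMeasure p) := by
      refine integral_mono hui.abs (hf.abs.add (hf.sub hui)) fun t => ?_
      have h3 := hu1 t
      exact abs_le.2 ⟨by linarith [neg_abs_le (f t)], by linarith [le_abs_self (f t)]⟩
    rw [integral_add (g := fun t => f t - ι u t) hf.abs (hf.sub hui), integral_sub hf hui] at h2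
    linarith
  obtain ⟨c₀, rfl⟩ := hWι u₀ hu₀
  obtain ⟨u, hu, hmax⟩ := (Metric.isCompact_of_isClosed_isBounded hBc hBb).exists_isMaxOn
    ⟨c₀, hle₀, le_rfl⟩ hcont.continuousOn
  refine ⟨ι u, ⟨hιW u, hu.1⟩, fun v hv => ?_⟩
  obtain ⟨c, rfl⟩ := hWι v hv.1
  rcases le_total (∫ t, ι c₀ t ∂(selfSimilarMeasure p)) (∫ t, ι c t ∂(selfSimilarMeasure p)) with h | h
  · exact hmax (show c ∈ B from ⟨hv.2, h⟩)
  · exact h.trans hu.2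

/-- A space of continuous functions with a positive member has a member below every function that
is bounded below. -/
lemma below_nonempty_of_pos (W : Submodule ℝ C(SG p, ℝ)) {u : C(SG p, ℝ)} (hu : u ∈ W) {δ : ℝ}
    (hδ : 0 < δ) (hpos : ∀ t, δ ≤ u t) {f : SG p → ℝ} (hf : BddBelow (range f)) :
    (below p W f).Nonempty := by
  obtain ⟨b, hb⟩ := hf
  refine ⟨(-(|b| / δ)) • u, W.smul_mem _ hu, fun t => ?_⟩
  have h1 : b ≤ f t := hb ⟨t, rfl⟩
  have h2 : |b| ≤ |b| / δ * u t := by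
    rw [div_mul_eq_mul_div, le_div_iff₀ hδ]
    exact mul_le_mul_of_nonneg_left (hpos t) (abs_nonneg b)
  rw [ContinuousMap.smul_apply, smul_eq_mul, neg_mul]
  linarith [neg_abs_le b]

lemma isFractalFunction_one {N : ℕ} {α : (Fin N → Fin 3) → C(SG p, ℝ)}
    {L : C(SG p, ℝ) →L[ℝ] C(SG p, ℝ)} (hL1 : L 1 = 1) : IsFractalFunction p α L 1 1 := by
  intro w t
  simp [hL1]

end SierpinskiGasket

end

open SierpinskiGasket

theorem mainTheorem7
    (p : Fin 3 → Plane) (hp : IsEquilateral p)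
    (N : ℕ) (hN : 1 ≤ N)
    (α : (Fin N → Fin 3) → C(SG p, ℝ)) (hα : ∀ w, ‖α w‖ < 1)
    (L : C(SG p, ℝ) →L[ℝ] C(SG p, ℝ))
    (hL : ∀ (g : C(SG p, ℝ)) (i : Fin 3), L g (vertex p i) = g (vertex p i)) :
    -- every class: existence as soon as the class has a competitor, and always if `L 1 = 1`
    (∀ S : Set C(SG p, ℝ),
      ((∃ m : ℕ, S = piecewiseHarmonic p m) ∨ (∃ n : ℕ, S = multiharmonic p n)) →
      ∀ f : SG p → ℝ, BddBelow (Set.range f) → Integrable f (selfSimilarMeasure p) →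
        ((below p (fractalClass p α L S) f).Nonempty ∨ L 1 = 1) →
        ∃ u, IsBestFromBelow p (fractalClass p α L S) f u) ∧
    -- unconditional existence on all sufficiently fine levels, uniformly in `f`
    ((∀ w, ‖α w‖ * ‖L‖ < 1) →
      ∃ M : ℕ, ∀ m : ℕ, M ≤ m →
        ∀ f : SG p → ℝ, BddBelow (Set.range f) → Integrable f (selfSimilarMeasure p) →
          ∃ u, IsBestFromBelow p (fractalClass p α L (piecewiseHarmonic p m)) f u) := by
  refine ⟨fun S hS f hfb hfi hne => ?_, fun hαL => ?_⟩
  · obtain ⟨W, hW, h1, rfl⟩ : ∃ W : Submodule ℝ C(SG p, ℝ), FiniteDimensional ℝ W ∧ 1 ∈ W ∧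
        (W : Set C(SG p, ℝ)) = S := by
      rcases hS with ⟨m, rfl⟩ | ⟨n, rfl⟩
      · exact ⟨piecewiseHarmonicSubmodule p m, inferInstance, one_mem_piecewiseHarmonic m, rfl⟩
      · exact exists_submodule_multiharmonic n
    have := finiteDimensional_fractal (L := L) hα W
    rw [← coe_relImage_fractalGraph] at hne ⊢
    refine exists_isBestFromBelow _ hfi (hne.elim id fun hL1 => ?_)
    exact below_nonempty_of_pos _ (mem_relImage.2 ⟨1, h1, isFractalFunction_one hL1⟩) one_pos
      (fun _ => le_rfl) hfb
  · obtain ⟨M, hM⟩ := exists_pos_fractal_piecewiseHarmonic hp hα hL hαL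
    refine ⟨M, fun m hm f hfb hfi => ?_⟩
    obtain ⟨u, hu, hpos⟩ := hM m hm
    have := finiteDimensional_fractal (L := L) hα (piecewiseHarmonicSubmodule p m)
    have h := exists_isBestFromBelow _ hfi (below_nonempty_of_pos _ hu (by norm_num) hpos hfb)
    rw [coe_relImage_fractalGraph] at h
    exact h
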